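/- Let $X,X_1,X_2,Y,Y_1,Y_2$ be random variables on a common probability space, taking values in finite sets $\mathcal X,\mathcal X_1,\mathcal X_2,\mathcal Y,\mathcal Y_1,\mathcal Y_2$. For probability mass functions (PMFs) $P,Q$ on a finite set, let $D(P\|Q)=\sum_x P(x)\log\frac{P(x)}{Q(x)}$ (with $0\log\frac0q=0$ for all $q\ge 0$, and $p\log\frac p0=\infty$ for $p>0$), and for $\alpha>0$, $\alpha\neq1$, let $$\Delta_\alpha(P\|Q)=\frac{\alpha}{1-\alpha}\log\sum_x P(x)Q(x)^{\alpha-1}+\log\sum_x Q(x)^\alpha-\frac1{1-\alpha}\log\sum_x P(x)^\alpha ,$$ where for $\alpha<1$ the term $P(x)Q(x)^{\alpha-1}$ is read as $P(x)/Q(x)^{1-\alpha}$ with $\frac00=0$ and $\frac p0=\infty$ for $p>0$, and where $\log 0=-\infty$, $\log\infty=\infty$; let $\Delta_1(P\|Q)=D(P\|Q)$. Define $$K_\alpha(X;Y)=\min_{Q_X,Q_Y}\Delta_\alpha(P_{XY}\|Q_XQ_Y),$$ the minimum being over all PMFs $Q_X$ on $\mathcal X$ and $Q_Y$ on $\mathcal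 Y$, where $P_{XY}$ is the joint PMF of $(X,Y)$. Let $I(X;Y)=D(P_{XY}\|P_XP_Y)$, let $H_\alpha(X)=\frac1{1-\alpha}\log\sum_xP_X(x)^\alpha$ for $\alpha>0$, $\alpha\ne1$, let $H_1(X)=\sum_xP_X(x)\log\frac1{P_X(x)}$ and $H_\infty(X)=-\log\max_xP_X(x)$. Then for every $\alpha>0$ the minimum defining $K_\alpha(X;Y)$ is attained, and: 1. $K_\alpha(X;Y)\ge0$, with equality if and only if $X$ and $Y$ are independent. 2. $K_\alpha(X;Y)=K_\alpha(Y;X)$. 3. If the pairs $(X_1,Y_1)$ and $(X_2,Y_2)$ are independent, then $K_\alpha(X_1,X_2;Y_1,Y_2)=K_\alpha(X_1;Y_1)+K_\alpha(X_2;Y_2)$. 4. $K_\alpha(X;Y)\le\log|\mathcal X|$ and $K_\alpha(X;Y)\le\log|\mathcal Y|$. In addition: 5. $K_1(X;Y)=I(X;Y)$. 6. $\alpha\mapsto K_\alpha(X;Y)$ is continuous on $(0,\infty)$. 7. $K_\alpha(X;X)=2H_{\frac{\alpha}{2-\alpha}}(X)-H_\alpha(X)$ for $\alpha\in(0,2)$,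 and $K_\alpha(X;X)=\frac{\alpha}{\alpha-1}H_\infty(X)-H_\alpha(X)$ for $\alpha\ge2$. -/

import Mathlib

open MeasureTheory ProbabilityTheory
open scoped ENNReal

namespace RelAlpha

/-- The probability mass function `z ↦ Pr[Z = z]` of a random variable `Z`, with values in
`[0, ∞]` so that it can be used in the extended-valued divergences below. -/
noncomputable def pmfOf {Ω ι : Type*} [MeasurableSpace Ω] (μ : Measure Ω) (Z : Ω → ι) : ι → ℝ≥0∞ :=
  fun z => μ (Z ⁻¹' {z})

/-- Product `(x, y) ↦ p x * q y` of two mass functions. -/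
noncomputable def prodPmf {ι κ : Type*} (p : ι → ℝ≥0∞) (q : κ → ℝ≥0∞) : ι × κ → ℝ≥0∞ :=
  fun z => p z.1 * q z.2

/-- Relative entropy `D(P‖Q) = ∑ P log (P / Q)` of mass functions on a finite set.
The arithmetic of `ℝ≥0∞` and `EReal` gives exactly the conventions
`0 log (0 / q) = 0` (also for `q = 0`) and `p log (p / 0) = ∞` for `p > 0`. -/
noncomputable def relEntropy {ι : Type*} [Fintype ι] (P Q : ι → ℝ≥0∞) : EReal :=
  ∑ x, (P x : EReal) * ENNReal.log (P x / Q x)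

/-- Relative `α`-entropy `Δ_α(P‖Q)` of mass functions on a finite set, for `α > 0`; at `α = 1` it
is the relative entropy. In `ℝ≥0∞`, for `α < 1`, the product `P x * Q x ^ (α - 1)` is `0` if
`P x = 0` and `∞` if `P x > 0 = Q x`; `ENNReal.log 0 = -∞` and `ENNReal.log ∞ = ∞`.
For probability mass functions the last two summands are finite. -/
noncomputable def relAlphaEntropy {ι : Type*} [Fintype ι] (α : ℝ) (P Q : ι → ℝ≥0∞) : EReal :=
  if α = 1 then relEntropy P Q
  else ((α / (1 - α) : ℝ) : EReal) * ENNReal.log (∑ x, P x * Q x ^ (α - 1))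
    + ENNReal.log (∑ x, Q x ^ α)
    - ((1 / (1 - α) : ℝ) : EReal) * ENNReal.log (∑ x, P x ^ α)

/-- `K_α(X;Y)`: the minimum of `Δ_α(P_XY‖Q_X Q_Y)` over all probability mass functions
`Q_X` and `Q_Y`, written as an infimum. -/
noncomputable def K {Ω 𝒳 𝒴 : Type*} [MeasurableSpace Ω] [Fintype 𝒳] [Fintype 𝒴]
    (μ : Measure Ω) (α : ℝ) (X : Ω → 𝒳) (Y : Ω → 𝒴) : EReal :=
  ⨅ (QX : PMF 𝒳) (QY : PMF 𝒴),
    relAlphaEntropy α (pmfOf μ (fun ω => (X ω, Y ω))) (prodPmf QX QY)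

/-- Mutual information `I(X;Y) = D(P_XY‖P_X P_Y)`. -/
noncomputable def mutualInfo {Ω 𝒳 𝒴 : Type*} [MeasurableSpace Ω] [Fintype 𝒳] [Fintype 𝒴]
    (μ : Measure Ω) (X : Ω → 𝒳) (Y : Ω → 𝒴) : EReal :=
  relEntropy (pmfOf μ (fun ω => (X ω, Y ω))) (prodPmf (pmfOf μ X) (pmfOf μ Y))

/-- Rényi entropy `H_α(X)` of order `α > 0`; at `α = 1` it is the Shannon entropy. -/
noncomputable def renyiEntropy {Ω 𝒳 : Type*} [MeasurableSpace Ω] [Fintype 𝒳]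
    (μ : Measure Ω) (α : ℝ) (X : Ω → 𝒳) : ℝ :=
  if α = 1 then ∑ x, (pmfOf μ X x).toReal * Real.log (1 / (pmfOf μ X x).toReal)
  else 1 / (1 - α) * Real.log (∑ x, (pmfOf μ X x).toReal ^ α)

/-- Rényi entropy of order infinity, `H_∞(X) = -log max_x P_X(x)`. -/
noncomputable def minEntropy {Ω 𝒳 : Type*} [MeasurableSpace Ω]
    (μ : Measure Ω) (X : Ω → 𝒳) : ℝ :=
  -Real.log (⨆ x, (pmfOf μ X x).toReal)

end RelAlpha

/-!
Write `T = Q ^ α / ∑ Q ^ α`, the escort of order `α` of `Q`; this is a bijection of the simplex and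
it sends products to products. In terms of `T`, the relative `α`-entropy of `P` from `Q` is
`log (M_{α-1}(P) / M_{1-1/α}(T))`, where `M_s(f) = (∑ P f ^ s) ^ (1/s)` is the power mean of order
`s` with weights `P`, the order `s = 0` (the geometric mean) covering `α = 1`. Hence `K_α(X;Y)` is
governed by the largest power mean of order `1 - 1/α` of a product mass function. This maximum is
attained and continuous in `α` because the simplex is compact and power means are jointly
continuous in the order and the function. It is multiplicative for independent pairs, and it is at
most `M_{α-1}(P)`, with equality only if the maximiser is the escort of `P`. On the diagonal, the
inequality `r t ≤ ((r + t) / 2) ^ 2` allows both factors to be taken equal, which leaves a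
one-variable maximisation.
-/

namespace RelAlpha

open Filter Topology

variable {ι κ : Type*}

theorem rpow_mul_rpow_sub_one {α : ℝ} (hα : 0 < α) {x : ℝ≥0∞} (hx : x ≠ ∞) :
    x * x ^ (α - 1) = x ^ α := by
  rcases eq_or_ne x 0 with rfl | h0
  · rw [zero_mul, ENNReal.zero_rpow_of_pos hα]
  · conv_lhs => rw [← ENNReal.rpow_one x, ← ENNReal.rpow_mul, one_mul, ← ENNReal.rpow_add _ _ h0 hx]
    rw [add_sub_cancel]

theorem mul_rpow_of_ne_zero_of_ne_top {c : ℝ≥0∞} (hc : c ≠ 0) (hc' : c ≠ ∞) (x : ℝ≥0∞) (s : ℝ) :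
    (c * x) ^ s = c ^ s * x ^ s := by
  simp [ENNReal.mul_rpow_eq_ite, hc, hc']

theorem continuousAt_rpow {s : ℝ} (hs : s ≠ 0) (x : ℝ≥0∞) :
    ContinuousAt (fun v : ℝ × ℝ≥0∞ => v.2 ^ v.1) (s, x) := by
  simp only [ENNReal.rpow_eq_exp_mul_log]
  have h_mul : ContinuousAt (fun v : EReal × EReal => v.1 * v.2) ((s : EReal), ENNReal.log x) :=
    EReal.continuousAt_mul (.inl (EReal.coe_ne_zero.2 hs)) (.inl (EReal.coe_ne_zero.2 hs))
      (.inl (EReal.coe_ne_bot s)) (.inl (EReal.coe_ne_top s))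
  exact (ENNReal.continuous_exp.continuousAt.comp h_mul).comp₂_of_eq
    (continuous_coe_real_ereal.comp continuous_fst).continuousAt
    (ENNReal.continuous_log.comp continuous_snd).continuousAt rfl

theorem coe_sum_ereal (t : Finset ι) (f : ι → ℝ) :
    ((∑ i ∈ t, f i : ℝ) : EReal) = ∑ i ∈ t, (f i : EReal) :=
  map_sum (⟨⟨Real.toEReal, EReal.coe_zero⟩, EReal.coe_add⟩ : ℝ →+ EReal) f t

theorem log_prod (t : Finset ι) (f : ι → ℝ≥0∞) :
    ENNReal.log (∏ i ∈ t, f i) = ∑ i ∈ t, ENNReal.log (f i) := by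
  induction t using Finset.cons_induction with
  | empty => simp
  | cons i t hi ih => rw [Finset.prod_cons, Finset.sum_cons, ENNReal.log_mul_add, ih]

theorem rpow_sum {t : Finset ι} {r : ι → ℝ} (hr : ∀ i ∈ t, 0 ≤ r i) (x : ℝ≥0∞) :
    x ^ (∑ i ∈ t, r i) = ∏ i ∈ t, x ^ r i := by
  induction t using Finset.cons_induction with
  | empty => simp
  | cons i t hi ih =>
    rw [Finset.forall_mem_cons] at hr
    rw [Finset.prod_cons, Finset.sum_cons,
      ENNReal.rpow_add_of_nonneg _ _ hr.1 (Finset.sum_nonneg hr.2), ih hr.2]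

section MassFunctions

open Classical in
/-- The push-forward of a mass function along `φ`: the law of `φ(Z)` when `p` is the law of `Z`.
Marginals, swapped pairs and the law of `(Z, Z)` are all of this form. -/
noncomputable def mapPmf [Fintype ι] (φ : ι → κ) (p : ι → ℝ≥0∞) : κ → ℝ≥0∞ :=
  fun k => ∑ i with φ i = k, p i

variable [Fintype ι] [Fintype κ] {p : ι → ℝ≥0∞} {q : κ → ℝ≥0∞}

theorem ne_top_of_mem_stdSimplex (hp : p ∈ stdSimplex ℝ≥0∞ ι) (i : ι) : p i ≠ ∞ :=
  ENNReal.sum_ne_top.1 (hp.2.trans_ne ENNReal.one_ne_top) i (Finset.mem_univ i)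

theorem le_one_of_mem_stdSimplex (hp : p ∈ stdSimplex ℝ≥0∞ ι) (i : ι) : p i ≤ 1 :=
  (Finset.single_le_sum (fun _ _ => zero_le) (Finset.mem_univ i)).trans_eq hp.2

theorem sum_toReal_of_mem_stdSimplex (hp : p ∈ stdSimplex ℝ≥0∞ ι) : ∑ i, (p i).toReal = 1 := by
  rw [← ENNReal.toReal_sum fun i _ => ne_top_of_mem_stdSimplex hp i, hp.2, ENNReal.toReal_one]

theorem exists_ne_zero_of_mem_stdSimplex (hp : p ∈ stdSimplex ℝ≥0∞ ι) : ∃ i, p i ≠ 0 := by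
  by_contra! h
  simpa [h] using hp.2

theorem isCompact_stdSimplex_ennreal : IsCompact (stdSimplex ℝ≥0∞ ι) := by
  refine IsClosed.isCompact ?_
  simp only [stdSimplex, zero_le, implies_true, true_and]
  exact isClosed_eq (continuous_finsetSum _ fun i _ => continuous_apply i) continuous_const

theorem pmf_mem_stdSimplex (Q : PMF ι) : ⇑Q ∈ stdSimplex ℝ≥0∞ ι :=
  ⟨fun _ => zero_le, by rw [← tsum_fintype (L := .unconditional _), Q.tsum_coe]⟩

theorem exists_pmf_coe_eq (hp : p ∈ stdSimplex ℝ≥0∞ ι) : ∃ Q : PMF ι, ⇑Q = p :=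
  ⟨PMF.ofFintype p hp.2, rfl⟩

theorem sum_mapPmf_mul (φ : ι → κ) (p : ι → ℝ≥0∞) (g : κ → ℝ≥0∞) :
    ∑ k, mapPmf φ p k * g k = ∑ i, p i * g (φ i) := by
  classical
  simp only [mapPmf, Finset.sum_mul]
  rw [← Finset.sum_fiberwise (s := Finset.univ) (g := φ)]
  refine Finset.sum_congr rfl fun k _ => Finset.sum_congr rfl fun i hi => ?_
  rw [(Finset.mem_filter.1 hi).2]

theorem mapPmf_mem_stdSimplex (φ : ι → κ) (hp : p ∈ stdSimplex ℝ≥0∞ ι) :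
    mapPmf φ p ∈ stdSimplex ℝ≥0∞ κ :=
  ⟨fun _ => zero_le, by simpa [hp.2] using sum_mapPmf_mul φ p 1⟩

omit [Fintype κ] in
theorem mapPmf_apply [DecidableEq κ] (φ : ι → κ) (p : ι → ℝ≥0∞) (k : κ) :
    mapPmf φ p k = ∑ i, if φ i = k then p i else 0 := by
  rw [mapPmf, Finset.sum_filter]
  congr! 2

omit [Fintype κ] in
theorem le_mapPmf_apply (φ : ι → κ) (p : ι → ℝ≥0∞) (i : ι) : p i ≤ mapPmf φ p (φ i) := by
  classical
  exact Finset.single_le_sum (f := p) (fun _ _ => zero_le) (by simp)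

omit [Fintype κ] in
theorem mapPmf_apply_of_injective {φ : ι → κ} (hφ : φ.Injective) (p : ι → ℝ≥0∞) (i : ι) :
    mapPmf φ p (φ i) = p i := by
  classical
  simp [mapPmf_apply, hφ.eq_iff]

theorem mapPmf_fst_apply (F : ι × κ → ℝ≥0∞) (i : ι) :
    mapPmf Prod.fst F i = ∑ k, F (i, k) := by
  classical
  simp [mapPmf_apply, Fintype.sum_prod_type_right]

theorem mapPmf_fst_prodPmf (p : ι → ℝ≥0∞) (hq : q ∈ stdSimplex ℝ≥0∞ κ) :
    mapPmf Prod.fst (prodPmf p q) = p := by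
  ext i
  simp only [mapPmf_fst_apply, prodPmf, ← Finset.mul_sum, hq.2, mul_one]

theorem mapPmf_snd_prodPmf (hp : p ∈ stdSimplex ℝ≥0∞ ι) (q : κ → ℝ≥0∞) :
    mapPmf Prod.snd (prodPmf p q) = q := by
  classical
  ext k
  simp [mapPmf_apply, prodPmf, Fintype.sum_prod_type, ← Finset.sum_mul, hp.2]

theorem prodPmf_mem_stdSimplex (hp : p ∈ stdSimplex ℝ≥0∞ ι) (hq : q ∈ stdSimplex ℝ≥0∞ κ) :
    prodPmf p q ∈ stdSimplex ℝ≥0∞ (ι × κ) :=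
  ⟨fun _ => zero_le, by
    simp only [prodPmf, Fintype.sum_prod_type, ← Finset.mul_sum, hq.2, mul_one, hp.2]⟩

end MassFunctions

section PowerMean

/-- The power mean of order `s` of the function `f` with respect to the weights `p`, with the
geometric mean at `s = 0`. If `f` vanishes at a point of positive weight, its means of order
`s ≤ 0` are `0`. -/
noncomputable def powerMean [Fintype ι] (s : ℝ) (p f : ι → ℝ≥0∞) : ℝ≥0∞ :=
  if s = 0 then ∏ i, f i ^ (p i).toReal else (∑ i, p i * f i ^ s) ^ (1 / s)

variable [Fintype ι] [Fintype κ] {p f g : ι → ℝ≥0∞} {s : ℝ}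

theorem powerMean_zero (p f : ι → ℝ≥0∞) : powerMean 0 p f = ∏ i, f i ^ (p i).toReal :=
  if_pos rfl

theorem powerMean_of_ne_zero (hs : s ≠ 0) (p f : ι → ℝ≥0∞) :
    powerMean s p f = (∑ i, p i * f i ^ s) ^ (1 / s) :=
  if_neg hs

theorem powerMean_one (p f : ι → ℝ≥0∞) : powerMean 1 p f = ∑ i, p i * f i := by
  simp [powerMean_of_ne_zero one_ne_zero]

theorem powerMean_rpow (hs : s ≠ 0) (p f : ι → ℝ≥0∞) :
    powerMean s p f ^ s = ∑ i, p i * f i ^ s := by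
  rw [powerMean_of_ne_zero hs, ← ENNReal.rpow_mul, one_div_mul_cancel hs, ENNReal.rpow_one]

theorem log_powerMean_zero (hp : p ∈ stdSimplex ℝ≥0∞ ι) (f : ι → ℝ≥0∞) :
    ENNReal.log (powerMean 0 p f) = ∑ i, (p i : EReal) * ENNReal.log (f i) := by
  rw [powerMean_zero, log_prod]
  exact Finset.sum_congr rfl fun i _ => by
    rw [ENNReal.log_rpow, EReal.coe_ennreal_toReal (ne_top_of_mem_stdSimplex hp i)]

theorem powerMean_neg (hs : s ≠ 0) (p f : ι → ℝ≥0∞) :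
    powerMean (-s) p f = (powerMean s p f⁻¹)⁻¹ := by
  simp only [powerMean_of_ne_zero (neg_ne_zero.2 hs), powerMean_of_ne_zero hs, Pi.inv_apply,
    ENNReal.inv_rpow, ← ENNReal.rpow_neg, one_div, inv_neg]

theorem powerMean_congr (s : ℝ) (h : ∀ i, p i ≠ 0 → f i = g i) :
    powerMean s p f = powerMean s p g := by
  have h_or : ∀ i, p i = 0 ∨ f i = g i := fun i => or_iff_not_imp_left.2 (h i)
  unfold powerMean
  congr 1
  · exact Finset.prod_congr rfl fun i _ => by rcases h_or i with hi | hi <;> simp [hi]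
  · congr 1
    exact Finset.sum_congr rfl fun i _ => by rcases h_or i with hi | hi <;> simp [hi]

theorem powerMean_mono (s : ℝ) (p : ι → ℝ≥0∞) (h : f ≤ g) : powerMean s p f ≤ powerMean s p g := by
  have of_pos {s : ℝ} (hs : 0 < s) {f g : ι → ℝ≥0∞} (h : f ≤ g) :
      powerMean s p f ≤ powerMean s p g := by
    simp only [powerMean_of_ne_zero hs.ne']
    gcongr with i
    exact h i
  rcases lt_trichotomy s 0 with hs | rfl | hs
  · rw [← neg_neg s, powerMean_neg (neg_ne_zero.2 hs.ne), powerMean_neg (neg_ne_zero.2 hs.ne)]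
    exact ENNReal.inv_le_inv.2 (of_pos (neg_pos.2 hs) fun i => ENNReal.inv_le_inv.2 (h i))
  · simp only [powerMean_zero]
    gcongr with i
    exact h i
  · exact of_pos hs h

theorem powerMean_mapPmf (hp : p ∈ stdSimplex ℝ≥0∞ ι) (s : ℝ) (φ : ι → κ) (f : κ → ℝ≥0∞) :
    powerMean s (mapPmf φ p) f = powerMean s p (f ∘ φ) := by
  rcases eq_or_ne s 0 with rfl | hs
  · classical
    rw [powerMean_zero, powerMean_zero, ← Finset.prod_fiberwise (s := Finset.univ) (g := φ)]
    refine Finset.prod_congr rfl fun k _ => ?_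
    rw [mapPmf, ENNReal.toReal_sum fun i _ => ne_top_of_mem_stdSimplex hp i,
      rpow_sum fun i _ => ENNReal.toReal_nonneg]
    refine Finset.prod_congr (by congr) fun i hi => ?_
    rw [Function.comp_apply, (Finset.mem_filter.1 hi).2]
  · simp only [powerMean_of_ne_zero hs, sum_mapPmf_mul φ p (fun k => f k ^ s), Function.comp_apply]

theorem powerMean_prodPmf (s : ℝ) (p : ι → ℝ≥0∞) (q : κ → ℝ≥0∞) (F : ι × κ → ℝ≥0∞) :
    powerMean s (prodPmf p q) F = powerMean s p fun i => powerMean s q fun k => F (i, k) := by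
  rcases eq_or_ne s 0 with rfl | hs
  · simp only [powerMean_zero, prodPmf, Fintype.prod_prod_type, ENNReal.toReal_mul]
    refine Finset.prod_congr rfl fun i _ => ?_
    rw [← ENNReal.prod_rpow_of_nonneg ENNReal.toReal_nonneg]
    exact Finset.prod_congr rfl fun k _ => by rw [← ENNReal.rpow_mul, mul_comm]
  · rw [powerMean_of_ne_zero hs, powerMean_of_ne_zero hs]
    simp only [powerMean_rpow hs, prodPmf, Fintype.sum_prod_type, Finset.mul_sum, mul_assoc]

theorem powerMean_const (hp : p ∈ stdSimplex ℝ≥0∞ ι) (s : ℝ) (c : ℝ≥0∞) :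
    powerMean s p (fun _ => c) = c := by
  rcases eq_or_ne s 0 with rfl | hs
  · rw [powerMean_zero, ← rpow_sum fun i _ => ENNReal.toReal_nonneg,
      sum_toReal_of_mem_stdSimplex hp, ENNReal.rpow_one]
  · rw [powerMean_of_ne_zero hs, ← Finset.sum_mul, hp.2, one_mul, ← ENNReal.rpow_mul,
      mul_one_div_cancel hs, ENNReal.rpow_one]

theorem powerMean_ne_zero (hp : p ∈ stdSimplex ℝ≥0∞ ι) (hf : ∀ i, p i ≠ 0 → f i ≠ 0) (s : ℝ) :
    powerMean s p f ≠ 0 := by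
  classical
  let g : ι → ℝ≥0∞ := fun i => if p i = 0 then ∞ else f i
  have h_inf : 0 < Finset.univ.inf g := by
    refine (Finset.lt_inf_iff ENNReal.zero_lt_top).2 fun i _ => ?_
    by_cases hi : p i = 0
    · simp [g, hi]
    · simpa [g, hi, pos_iff_ne_zero] using hf i hi
  rw [powerMean_congr (g := g) s fun i hi => (if_neg hi).symm]
  refine (h_inf.trans_le ?_).ne'
  rw [← powerMean_const hp s (Finset.univ.inf g)]
  exact powerMean_mono s p fun i => Finset.inf_le (Finset.mem_univ i)

theorem powerMean_zero_mul (p f g : ι → ℝ≥0∞) :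
    powerMean 0 p (f * g) = powerMean 0 p f * powerMean 0 p g := by
  simp only [powerMean_zero, Pi.mul_apply, ENNReal.mul_rpow_of_nonneg _ _ ENNReal.toReal_nonneg,
    Finset.prod_mul_distrib]

theorem powerMean_const_mul (hp : p ∈ stdSimplex ℝ≥0∞ ι) (s : ℝ) {c : ℝ≥0∞} (hc : c ≠ ∞)
    (f : ι → ℝ≥0∞) : powerMean s p (fun i => c * f i) = c * powerMean s p f := by
  rcases eq_or_ne c 0 with rfl | hc0
  · simpa only [zero_mul] using powerMean_const hp s 0
  rcases eq_or_ne s 0 with rfl | hs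
  · rw [show (fun i => c * f i) = (fun _ => c) * f from rfl, powerMean_zero_mul, powerMean_const hp]
  · simp only [powerMean_of_ne_zero hs, mul_rpow_of_ne_zero_of_ne_top hc0 hc, mul_left_comm (p _),
      ← Finset.mul_sum]
    rw [mul_rpow_of_ne_zero_of_ne_top (by simp [hc0, hc]) (by simp [hc0, hc]), ← ENNReal.rpow_mul,
      mul_one_div_cancel hs, ENNReal.rpow_one]

theorem powerMean_sq (s : ℝ) (p f : ι → ℝ≥0∞) :
    powerMean s p (fun i => f i ^ (2 : ℝ)) = powerMean (2 * s) p f ^ (2 : ℝ) := by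
  rcases eq_or_ne s 0 with rfl | hs
  · rw [mul_zero, powerMean_zero, powerMean_zero, ← ENNReal.prod_rpow_of_nonneg zero_le_two]
    exact Finset.prod_congr rfl fun i _ => by rw [← ENNReal.rpow_mul, ← ENNReal.rpow_mul, mul_comm]
  · simp only [powerMean_of_ne_zero hs, powerMean_of_ne_zero (mul_ne_zero two_ne_zero hs),
      ← ENNReal.rpow_mul]
    congr 1
    field_simp

end PowerMean

section PowerMeanOrder

variable [Fintype ι] {p f : ι → ℝ≥0∞} {s s' : ℝ}

theorem powerMean_le_powerMean_of_pos (hp : p ∈ stdSimplex ℝ≥0∞ ι) (hs : 0 < s) (h : s ≤ s')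
    (f : ι → ℝ≥0∞) : powerMean s p f ≤ powerMean s' p f := by
  have hs' : 0 < s' := hs.trans_le h
  have h_jensen : powerMean s p f ^ s' ≤ powerMean s' p f ^ s' := by
    have := ENNReal.rpow_arith_mean_le_arith_mean_rpow Finset.univ p (fun i => f i ^ s) hp.2
      ((one_le_div hs).2 h)
    simpa only [powerMean_of_ne_zero hs.ne', powerMean_of_ne_zero hs'.ne', ← ENNReal.rpow_mul,
      mul_div_cancel₀ _ hs.ne', one_div_mul_cancel hs'.ne', ENNReal.rpow_one, div_mul_eq_mul_div,
      one_mul] using this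
  exact (ENNReal.rpow_le_rpow_iff hs').1 h_jensen

theorem powerMean_zero_le_powerMean_one (hp : p ∈ stdSimplex ℝ≥0∞ ι) (f : ι → ℝ≥0∞) :
    powerMean 0 p f ≤ powerMean 1 p f := by
  by_cases hf : ∃ i, p i ≠ 0 ∧ f i = ∞
  · obtain ⟨i, hpi, hfi⟩ := hf
    rw [powerMean_one, ENNReal.sum_eq_top.2 ⟨i, Finset.mem_univ i, by simp [hfi, hpi]⟩]
    exact le_top
  push Not at hf
  have h_toNNReal : ∀ i, p i ≠ 0 → f i = (f i).toNNReal :=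
    fun i hi => (ENNReal.coe_toNNReal (hf i hi)).symm
  rw [powerMean_congr 0 h_toNNReal, powerMean_congr 1 h_toNNReal, powerMean_zero, powerMean_one]
  lift p to ι → NNReal using ne_top_of_mem_stdSimplex hp
  have h_amgm := NNReal.geom_mean_le_arith_mean_weighted Finset.univ p (fun i => (f i).toNNReal)
    (by exact_mod_cast (show ∑ i, (p i : ℝ≥0∞) = 1 from hp.2))
  simp only [ENNReal.coe_toReal, ← ENNReal.coe_rpow_of_nonneg _ (NNReal.coe_nonneg _)]
  exact_mod_cast h_amgm

theorem powerMean_zero_le_powerMean_of_pos (hp : p ∈ stdSimplex ℝ≥0∞ ι) (hs : 0 < s)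
    (f : ι → ℝ≥0∞) : powerMean 0 p f ≤ powerMean s p f := by
  have h_amgm := powerMean_zero_le_powerMean_one hp (fun i => f i ^ s)
  rw [powerMean_one, ← powerMean_rpow hs.ne'] at h_amgm
  refine (ENNReal.rpow_le_rpow_iff hs).1 (le_trans (le_of_eq ?_) h_amgm)
  rw [powerMean_zero, powerMean_zero, ← ENNReal.prod_rpow_of_nonneg hs.le]
  exact Finset.prod_congr rfl fun i _ => by rw [← ENNReal.rpow_mul, ← ENNReal.rpow_mul, mul_comm]

theorem powerMean_eq_zero_of_nonpos {i : ι} (hs : s ≤ 0) (hp : p i ≠ ∞) (hpi : p i ≠ 0)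
    (hfi : f i = 0) : powerMean s p f = 0 := by
  rcases hs.lt_or_eq with hs | rfl
  · have h_term : p i * f i ^ s = ∞ := by
      rw [hfi, ENNReal.zero_rpow_of_neg hs, ENNReal.mul_top hpi]
    rw [powerMean_of_ne_zero hs.ne, ENNReal.sum_eq_top.2 ⟨i, Finset.mem_univ i, h_term⟩,
      ENNReal.top_rpow_of_neg (one_div_neg.2 hs)]
  · refine (powerMean_zero p f).trans (Finset.prod_eq_zero (Finset.mem_univ i) ?_)
    rw [hfi, ENNReal.zero_rpow_of_pos (ENNReal.toReal_pos hpi hp)]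

theorem powerMean_zero_inv (hf : ∀ i, p i ≠ 0 → f i ≠ 0) :
    powerMean 0 p f⁻¹ = (powerMean 0 p f)⁻¹ := by
  have h_ne : ∀ i, f i ^ (p i).toReal ≠ 0 := by
    intro i
    rcases eq_or_ne (p i) 0 with hi | hi
    · simp [hi]
    · exact fun h => (ENNReal.rpow_pos_of_nonneg (pos_iff_ne_zero.2 (hf i hi))
        ENNReal.toReal_nonneg).ne' h
  simp only [powerMean_zero, Pi.inv_apply, ENNReal.inv_rpow]
  rw [ENNReal.prod_inv_distrib fun i _ j _ _ => .inl (h_ne i)]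

theorem powerMean_le_powerMean_zero_of_neg (hp : p ∈ stdSimplex ℝ≥0∞ ι) (hs : s < 0)
    (f : ι → ℝ≥0∞) : powerMean s p f ≤ powerMean 0 p f := by
  by_cases hf : ∃ i, p i ≠ 0 ∧ f i = 0
  · obtain ⟨i, hpi, hfi⟩ := hf
    rw [powerMean_eq_zero_of_nonpos hs.le (ne_top_of_mem_stdSimplex hp i) hpi hfi]
    exact zero_le
  · push Not at hf
    rw [← neg_neg s, powerMean_neg (neg_ne_zero.2 hs.ne), ← inv_inv (powerMean 0 p f),
      ← powerMean_zero_inv hf]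
    exact ENNReal.inv_le_inv.2 (powerMean_zero_le_powerMean_of_pos hp (neg_pos.2 hs) f⁻¹)

theorem powerMean_le_powerMean_of_neg (hp : p ∈ stdSimplex ℝ≥0∞ ι) (h : s ≤ s') (hs' : s' < 0)
    (f : ι → ℝ≥0∞) : powerMean s p f ≤ powerMean s' p f := by
  rw [← neg_neg s, ← neg_neg s', powerMean_neg (neg_ne_zero.2 (h.trans_lt hs').ne),
    powerMean_neg (neg_ne_zero.2 hs'.ne)]
  exact ENNReal.inv_le_inv.2
    (powerMean_le_powerMean_of_pos hp (neg_pos.2 hs') (neg_le_neg h) f⁻¹)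

theorem monotone_powerMean (hp : p ∈ stdSimplex ℝ≥0∞ ι) (f : ι → ℝ≥0∞) :
    Monotone fun s => powerMean s p f := by
  intro s s' h
  rcases lt_trichotomy s 0 with hs | rfl | hs
  · rcases lt_or_ge s' 0 with hs' | hs'
    · exact powerMean_le_powerMean_of_neg hp h hs' f
    · refine (powerMean_le_powerMean_zero_of_neg hp hs f).trans ?_
      rcases hs'.eq_or_lt with rfl | hs'
      · exact le_rfl
      · exact powerMean_zero_le_powerMean_of_pos hp hs' f
  · rcases h.eq_or_lt with rfl | h
    · exact le_rfl
    · exact powerMean_zero_le_powerMean_of_pos hp h f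
  · exact powerMean_le_powerMean_of_pos hp hs h f

end PowerMeanOrder

section PowerMeanContinuity

variable [Fintype ι] {p f : ι → ℝ≥0∞} {s : ℝ}

theorem continuousAt_powerMean_of_ne_zero (hs : s ≠ 0) (hp : ∀ i, p i ≠ ∞) (f : ι → ℝ≥0∞) :
    ContinuousAt (fun v : ℝ × (ι → ℝ≥0∞) => powerMean v.1 p v.2) (s, f) := by
  have h_sum : ContinuousAt (fun v : ℝ × (ι → ℝ≥0∞) => ∑ i, p i * v.2 i ^ v.1) (s, f) := by
    refine tendsto_finsetSum _ fun i _ => ENNReal.Tendsto.const_mul ?_ (.inr (hp i))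
    exact (continuousAt_rpow hs (f i)).comp₂_of_eq continuousAt_fst
      ((continuous_apply i).comp continuous_snd).continuousAt rfl
  have h_pow : ContinuousAt (fun v : ℝ × (ι → ℝ≥0∞) => (∑ i, p i * v.2 i ^ v.1) ^ (1 / v.1))
      (s, f) :=
    (continuousAt_rpow (one_div_ne_zero hs) _).comp₂_of_eq
      (continuousAt_const.div continuousAt_fst hs) h_sum rfl
  refine h_pow.congr ?_
  filter_upwards [continuousAt_fst.eventually_ne hs] with v hv
  rw [powerMean_of_ne_zero hv]

theorem continuous_powerMean_right (hs : s ≠ 0) (hp : ∀ i, p i ≠ ∞) :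
    Continuous fun f => powerMean s p f :=
  continuous_iff_continuousAt.2 fun f =>
    (continuousAt_powerMean_of_ne_zero hs hp f).comp₂_of_eq continuousAt_const continuousAt_id rfl

theorem hasDerivAt_log_sum_mul_rpow {w x : ι → ℝ} (hw : ∑ i, w i = 1) (hx : ∀ i, 0 < x i) :
    HasDerivAt (fun s : ℝ => Real.log (∑ i, w i * x i ^ s)) (∑ i, w i * Real.log (x i)) 0 := by
  have h_sum : HasDerivAt (fun s : ℝ => ∑ i, w i * x i ^ s) (∑ i, w i * Real.log (x i)) 0 := by
    refine HasDerivAt.fun_sum fun i _ => ?_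
    simpa using ((Real.hasStrictDerivAt_const_rpow (hx i) 0).hasDerivAt).const_mul (w i)
  simpa [hw] using h_sum.log (by simp [hw])

theorem log_powerMean_eq_slope (hp : p ∈ stdSimplex ℝ≥0∞ ι) (h0 : ∀ i, f i ≠ 0)
    (hf : ∀ i, f i ≠ ∞) (hs : s ≠ 0) :
    ENNReal.log (powerMean s p f) =
      (slope (fun s => Real.log (∑ i, (p i).toReal * (f i).toReal ^ s)) 0 s : ℝ) := by
  have h_ne_top : ∀ i, p i * f i ^ s ≠ ∞ := fun i =>
    ENNReal.mul_ne_top (ne_top_of_mem_stdSimplex hp i)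
      (ENNReal.rpow_ne_top_of_ne_zero (h0 i) (hf i))
  have h_ne_zero : ∑ i, p i * f i ^ s ≠ 0 := by
    obtain ⟨i, hi⟩ := exists_ne_zero_of_mem_stdSimplex hp
    have h_pos : f i ^ s ≠ 0 := (ENNReal.rpow_pos (pos_iff_ne_zero.2 (h0 i)) (hf i)).ne'
    exact fun h => mul_ne_zero hi h_pos (Finset.sum_eq_zero_iff.1 h i (Finset.mem_univ i))
  rw [powerMean_of_ne_zero hs, ENNReal.log_rpow,
    ENNReal.log_pos_real h_ne_zero (ENNReal.sum_ne_top.2 fun i _ => h_ne_top i),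
    ENNReal.toReal_sum fun i _ => h_ne_top i, ← EReal.coe_mul]
  simp [slope_def_field, sum_toReal_of_mem_stdSimplex hp, ENNReal.toReal_rpow, div_eq_inv_mul]

theorem tendsto_powerMean_zero (hp : p ∈ stdSimplex ℝ≥0∞ ι) (h0 : ∀ i, p i ≠ 0 → f i ≠ 0)
    (hf : ∀ i, f i ≠ ∞) :
    Tendsto (fun s => powerMean s p f) (𝓝[≠] 0) (𝓝 (powerMean 0 p f)) := by
  wlog h0' : ∀ i, f i ≠ 0 generalizing f
  · classical
    have h_congr : ∀ i, p i ≠ 0 → f i = if p i = 0 then 1 else f i := fun i hi => (if_neg hi).symm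
    simp only [powerMean_congr _ h_congr]
    apply this <;> intro i <;> split_ifs with hi <;> simp [h0 i, hf i, hi]
  have h_slope := hasDerivAt_iff_tendsto_slope.1 (hasDerivAt_log_sum_mul_rpow
    (w := fun i => (p i).toReal) (x := fun i => (f i).toReal)
    (sum_toReal_of_mem_stdSimplex hp) fun i => ENNReal.toReal_pos (h0' i) (hf i))
  have h_log : ENNReal.log (powerMean 0 p f) =
      ((∑ i, (p i).toReal * Real.log (f i).toReal : ℝ) : EReal) := by
    rw [log_powerMean_zero hp, coe_sum_ereal]
    refine Finset.sum_congr rfl fun i _ => ?_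
    rw [EReal.coe_mul, EReal.coe_ennreal_toReal (ne_top_of_mem_stdSimplex hp i),
      ENNReal.log_pos_real (h0' i) (hf i)]
  have h_tendsto_log : Tendsto (fun s => ENNReal.log (powerMean s p f)) (𝓝[≠] 0)
      (𝓝 (ENNReal.log (powerMean 0 p f))) := by
    rw [h_log]
    refine ((continuous_coe_real_ereal.tendsto _).comp h_slope).congr' ?_
    filter_upwards [self_mem_nhdsWithin] with s hs
    exact (log_powerMean_eq_slope hp h0' hf hs).symm
  simpa only [Function.comp_def, ENNReal.exp_log] using
    (ENNReal.continuous_exp.tendsto _).comp h_tendsto_log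

theorem tendsto_powerMean_zero_sup (hf : ∀ i, f i ≠ ∞) :
    Tendsto (fun η : ℝ≥0∞ => powerMean 0 p (fun i => f i ⊔ η)) (𝓝 0) (𝓝 (powerMean 0 p f)) := by
  simp only [powerMean_zero]
  refine ENNReal.tendsto_finsetProd_of_ne_top _ (fun i _ => ?_) fun i _ =>
    ENNReal.rpow_ne_top_of_nonneg ENNReal.toReal_nonneg (hf i)
  have h_sup : Tendsto (fun η : ℝ≥0∞ => f i ⊔ η) (𝓝 0) (𝓝 (f i)) := by
    simpa using (tendsto_const_nhds (x := f i)).max (tendsto_id (x := 𝓝 (0 : ℝ≥0∞)))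
  exact h_sup.ennrpow_const _

theorem continuousAt_powerMean_zero (hp : p ∈ stdSimplex ℝ≥0∞ ι) (hf : ∀ i, f i ≠ ∞) :
    ContinuousAt (fun v : ℝ × (ι → ℝ≥0∞) => powerMean v.1 p v.2) (0, f) := by
  refine tendsto_order.2 ⟨fun a ha => ?_, fun b hb => ?_⟩
  · have h0 : ∀ i, p i ≠ 0 → f i ≠ 0 := fun i hi hfi =>
      not_lt_zero (ha.trans_eq
        (powerMean_eq_zero_of_nonpos le_rfl (ne_top_of_mem_stdSimplex hp i) hi hfi))
    have h_lim := (tendsto_powerMean_zero hp h0 hf).mono_left (nhdsLT_le_nhdsNE 0)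
    obtain ⟨δ, haδ, hδ : δ < 0⟩ :=
      ((h_lim.eventually_const_lt ha).and self_mem_nhdsWithin).exists
    have h_cont := continuous_powerMean_right hδ.ne (ne_top_of_mem_stdSimplex hp)
    filter_upwards [(h_cont.comp continuous_snd).continuousAt.eventually_const_lt haδ,
      continuousAt_fst.eventually_const_lt hδ] with v hv hvδ
    exact hv.trans_le (monotone_powerMean hp v.2 hvδ.le)
  · have h_sup := (tendsto_powerMean_zero_sup (p := p) hf).mono_left
      (nhdsWithin_le_nhds (s := Set.Ioi 0))
    obtain ⟨η, hη, hη0, hη1⟩ :=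
      ((h_sup.eventually_lt_const hb).and (Ioo_mem_nhdsGT one_pos)).exists
    have h0 : ∀ i, p i ≠ 0 → f i ⊔ η ≠ 0 := fun i _ => (lt_sup_of_lt_right hη0).ne'
    have h_top : ∀ i, f i ⊔ η ≠ ∞ := fun i => (max_lt (hf i).lt_top (hη1.trans_le le_top)).ne
    have h_lim := (tendsto_powerMean_zero hp h0 h_top).mono_left (nhdsGT_le_nhdsNE 0)
    obtain ⟨δ, hbδ, hδ : 0 < δ⟩ :=
      ((h_lim.eventually_lt_const hη).and self_mem_nhdsWithin).exists
    have hfδ : powerMean δ p f < b := (powerMean_mono δ p fun i => le_sup_left).trans_lt hbδ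
    have h_cont := continuous_powerMean_right hδ.ne' (ne_top_of_mem_stdSimplex hp)
    filter_upwards [(h_cont.comp continuous_snd).continuousAt.eventually_lt_const hfδ,
      continuousAt_fst.eventually_lt_const hδ] with v hv hvδ
    exact (monotone_powerMean hp v.2 hvδ.le).trans_lt hv

theorem continuousAt_powerMean (hp : p ∈ stdSimplex ℝ≥0∞ ι) (hf : ∀ i, f i ≠ ∞) (s : ℝ) :
    ContinuousAt (fun v : ℝ × (ι → ℝ≥0∞) => powerMean v.1 p v.2) (s, f) := by
  rcases eq_or_ne s 0 with rfl | hs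
  · exact continuousAt_powerMean_zero hp hf
  · exact continuousAt_powerMean_of_ne_zero hs (ne_top_of_mem_stdSimplex hp) f

end PowerMeanContinuity

section Escort

/-- The escort distribution of order `a > 0` of the mass function `p`: the normalisation of
`p ^ a`. -/
noncomputable def escort [Fintype ι] (a : ℝ) (p : ι → ℝ≥0∞) : ι → ℝ≥0∞ :=
  fun i => p i ^ a / ∑ j, p j ^ a

variable [Fintype ι] [Fintype κ] {p u T : ι → ℝ≥0∞} {a s : ℝ}

theorem sum_rpow_ne_zero (ha : 0 < a) (hp : p ∈ stdSimplex ℝ≥0∞ ι) : ∑ i, p i ^ a ≠ 0 := by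
  obtain ⟨i, hi⟩ := exists_ne_zero_of_mem_stdSimplex hp
  exact fun h => hi ((ENNReal.rpow_eq_zero_iff_of_pos ha).1
    (Finset.sum_eq_zero_iff.1 h i (Finset.mem_univ i)))

theorem sum_rpow_ne_top (ha : 0 ≤ a) (hp : p ∈ stdSimplex ℝ≥0∞ ι) : ∑ i, p i ^ a ≠ ∞ :=
  ENNReal.sum_ne_top.2 fun i _ => ENNReal.rpow_ne_top_of_nonneg ha (ne_top_of_mem_stdSimplex hp i)

theorem escort_mem_stdSimplex (ha : 0 < a) (hp : p ∈ stdSimplex ℝ≥0∞ ι) :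
    escort a p ∈ stdSimplex ℝ≥0∞ ι :=
  ⟨fun _ => zero_le, by
    simp only [escort, div_eq_mul_inv, ← Finset.sum_mul]
    exact ENNReal.mul_inv_cancel (sum_rpow_ne_zero ha hp) (sum_rpow_ne_top ha.le hp)⟩

theorem escort_one (hp : p ∈ stdSimplex ℝ≥0∞ ι) : escort 1 p = p := by
  ext i
  simp [escort, hp.2]

theorem escort_apply_rpow (ha : 0 < a) (hp : p ∈ stdSimplex ℝ≥0∞ ι) (b : ℝ) (i : ι) :
    escort a p i ^ b = p i ^ (a * b) * (∑ j, p j ^ a) ^ (-b) := by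
  rw [escort, div_eq_mul_inv, mul_comm,
    mul_rpow_of_ne_zero_of_ne_top (ENNReal.inv_ne_zero.2 (sum_rpow_ne_top ha.le hp))
      (ENNReal.inv_ne_top.2 (sum_rpow_ne_zero ha hp)),
    ENNReal.inv_rpow, ← ENNReal.rpow_neg, ← ENNReal.rpow_mul, mul_comm]

theorem sum_escort_rpow (ha : 0 < a) (hp : p ∈ stdSimplex ℝ≥0∞ ι) (b : ℝ) :
    ∑ i, escort a p i ^ b = (∑ i, p i ^ (a * b)) * (∑ i, p i ^ a) ^ (-b) := by
  simp only [escort_apply_rpow ha hp, Finset.sum_mul]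

theorem escort_escort (ha : 0 < a) (hp : p ∈ stdSimplex ℝ≥0∞ ι) (b : ℝ) :
    escort b (escort a p) = escort (a * b) p := by
  have h_pos := pos_iff_ne_zero.2 (sum_rpow_ne_zero ha hp)
  have h_top := sum_rpow_ne_top ha.le hp
  ext i
  rw [escort, sum_escort_rpow ha hp, escort_apply_rpow ha hp,
    ENNReal.mul_div_mul_right _ _ (ENNReal.rpow_pos h_pos h_top).ne'
      (ENNReal.rpow_ne_top_of_ne_zero h_pos.ne' h_top), escort]

theorem escort_inv_escort (ha : 0 < a) (hp : p ∈ stdSimplex ℝ≥0∞ ι) :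
    escort a⁻¹ (escort a p) = p := by
  rw [escort_escort ha hp, mul_inv_cancel₀ ha.ne', escort_one hp]

theorem escort_prodPmf (ha : 0 < a) (hp : p ∈ stdSimplex ℝ≥0∞ ι) (q : κ → ℝ≥0∞) :
    escort a (prodPmf p q) = prodPmf (escort a p) (escort a q) := by
  ext z
  simp only [escort, prodPmf, ENNReal.mul_rpow_of_nonneg _ _ ha.le, Fintype.sum_prod_type,
    ← Finset.mul_sum, ← Finset.sum_mul]
  exact ENNReal.mul_div_mul_comm (.inl (sum_rpow_ne_zero ha hp)) (.inl (sum_rpow_ne_top ha.le hp))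

theorem powerMean_div_self_le_one (hs : s ≤ 1) (hu : u ∈ stdSimplex ℝ≥0∞ ι)
    (hT : T ∈ stdSimplex ℝ≥0∞ ι) : powerMean s u (fun i => T i / u i) ≤ 1 :=
  calc powerMean s u (fun i => T i / u i)
      ≤ powerMean 1 u (fun i => T i / u i) := monotone_powerMean hu _ hs
    _ = ∑ i, u i * (T i / u i) := powerMean_one _ _
    _ ≤ ∑ i, T i := Finset.sum_le_sum fun _ _ => ENNReal.mul_div_le
    _ = 1 := hT.2

theorem mul_div_rpow (hs : s < 1) {x : ℝ≥0∞} (hx : x ≠ ∞) (y : ℝ≥0∞) :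
    x * (y / x) ^ s = x ^ (1 - s) * y ^ s := by
  rcases eq_or_ne x 0 with rfl | h0
  · rw [zero_mul, ENNReal.zero_rpow_of_pos (sub_pos.2 hs), zero_mul]
  · rw [div_eq_mul_inv, mul_comm y, mul_rpow_of_ne_zero_of_ne_top (ENNReal.inv_ne_zero.2 hx)
      (ENNReal.inv_ne_top.2 h0), ENNReal.inv_rpow, ← ENNReal.rpow_neg, ← mul_assoc,
      sub_eq_add_neg, ENNReal.rpow_add _ _ h0 hx, ENNReal.rpow_one]

theorem eq_of_sum_rpow_mul_rpow_eq_one {a b : ι → ℝ} (ha : ∀ i, 0 ≤ a i) (hb : ∀ i, 0 ≤ b i)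
    (ha1 : ∑ i, a i = 1) (hb1 : ∑ i, b i = 1) (h0 : 0 < s) (h1 : s < 1)
    (h : ∑ i, a i ^ (1 - s) * b i ^ s = 1) : a = b := by
  have h_amgm : ∀ i ∈ Finset.univ, a i ^ (1 - s) * b i ^ s ≤ (1 - s) * a i + s * b i := fun i _ =>
    Real.geom_mean_le_arith_mean2_weighted (sub_pos.2 h1).le h0.le (ha i) (hb i)
      (sub_add_cancel 1 s)
  have h_sum : ∑ i, ((1 - s) * a i + s * b i) = 1 := by
    rw [Finset.sum_add_distrib, ← Finset.mul_sum, ← Finset.mul_sum, ha1, hb1]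
    ring
  ext i
  exact (Real.geom_mean_eq_arith_mean2_weighted_iff_of_pos (sub_pos.2 h1) h0 (ha i) (hb i)
    (sub_add_cancel 1 s)).1
    ((Finset.sum_eq_sum_iff_of_le h_amgm).1 (h.trans h_sum.symm) i (Finset.mem_univ i))

theorem eq_of_powerMean_div_self_eq_one (hs : s < 1) (hu : u ∈ stdSimplex ℝ≥0∞ ι)
    (hT : T ∈ stdSimplex ℝ≥0∞ ι) (h : powerMean s u (fun i => T i / u i) = 1) : T = u := by
  have hu' := ne_top_of_mem_stdSimplex hu
  have hT' := ne_top_of_mem_stdSimplex hT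
  obtain ⟨t, hst, ht0, ht1⟩ : ∃ t, s ≤ t ∧ 0 < t ∧ t < 1 :=
    ⟨max s 2⁻¹, le_max_left _ _, by positivity, max_lt hs (by norm_num)⟩
  have h_mean : powerMean t u (fun i => T i / u i) = 1 :=
    le_antisymm (powerMean_div_self_le_one ht1.le hu hT)
      (h.ge.trans (monotone_powerMean hu _ hst))
  have h_sum : ∑ i, u i ^ (1 - t) * T i ^ t = 1 := by
    rw [← ENNReal.one_rpow t, ← h_mean, powerMean_rpow ht0.ne']
    exact Finset.sum_congr rfl fun i _ => (mul_div_rpow ht1 (hu' i) (T i)).symm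
  have h_real : ∑ i, (u i).toReal ^ (1 - t) * (T i).toReal ^ t = 1 := by
    have h_toReal := congrArg ENNReal.toReal h_sum
    rw [ENNReal.toReal_sum fun i _ => ENNReal.mul_ne_top
      (ENNReal.rpow_ne_top_of_nonneg (sub_pos.2 ht1).le (hu' i))
      (ENNReal.rpow_ne_top_of_nonneg ht0.le (hT' i)), ENNReal.toReal_one] at h_toReal
    simpa only [ENNReal.toReal_mul, ENNReal.toReal_rpow] using h_toReal
  have h_eq := eq_of_sum_rpow_mul_rpow_eq_one (fun _ => ENNReal.toReal_nonneg)
    (fun _ => ENNReal.toReal_nonneg) (sum_toReal_of_mem_stdSimplex hu)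
    (sum_toReal_of_mem_stdSimplex hT) ht0 ht1 h_real
  ext i
  exact ((ENNReal.toReal_eq_toReal_iff' (hu' i) (hT' i)).1 (congrFun h_eq i)).symm

end Escort

section GibbsHolder

variable [Fintype ι] {p T : ι → ℝ≥0∞} {α : ℝ}

theorem powerMean_eq_mul_powerMean_div_escort (hα : 0 < α) (hp : p ∈ stdSimplex ℝ≥0∞ ι)
    (T : ι → ℝ≥0∞) : powerMean (1 - α⁻¹) p T =
      powerMean (α - 1) p p * powerMean (1 - α⁻¹) (escort α p) (fun i => T i / escort α p i) := by
  have hp' := ne_top_of_mem_stdSimplex hp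
  rcases eq_or_ne α 1 with rfl | hα1
  · simp only [inv_one, sub_self, escort_one hp]
    rw [← powerMean_zero_mul]
    exact powerMean_congr 0 fun i hi => (ENNReal.mul_div_cancel hi (hp' i)).symm
  · have hZ0 := sum_rpow_ne_zero hα hp
    have hZ := sum_rpow_ne_top hα.le hp
    have hα1' : α - 1 ≠ 0 := sub_ne_zero.2 hα1
    have hs : 1 - α⁻¹ ≠ 0 := sub_ne_zero.2 fun h => hα1 (inv_eq_one.1 h.symm)
    have h_term : ∀ i, p i * T i ^ (1 - α⁻¹) = (∑ j, p j ^ α) ^ α⁻¹ *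
        (escort α p i * (T i / escort α p i) ^ (1 - α⁻¹)) := by
      intro i
      rw [mul_div_rpow (sub_lt_self 1 (inv_pos.2 hα))
        (ne_top_of_mem_stdSimplex (escort_mem_stdSimplex hα hp) i), sub_sub_cancel,
        escort_apply_rpow hα hp, mul_inv_cancel₀ hα.ne', ENNReal.rpow_one, ← mul_assoc,
        mul_left_comm, ← ENNReal.rpow_add _ _ hZ0 hZ, add_neg_cancel, ENNReal.rpow_zero, mul_one]
    rw [powerMean_of_ne_zero hs, powerMean_of_ne_zero hs, powerMean_of_ne_zero hα1']
    simp only [h_term, rpow_mul_rpow_sub_one hα (hp' _), ← Finset.mul_sum]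
    rw [mul_rpow_of_ne_zero_of_ne_top (by simp [hZ0, hZ]) (by simp [hZ0, hZ]), ← ENNReal.rpow_mul]
    congr 2
    field_simp

theorem powerMean_le_powerMean_self (hα : 0 < α) (hp : p ∈ stdSimplex ℝ≥0∞ ι)
    (hT : T ∈ stdSimplex ℝ≥0∞ ι) : powerMean (1 - α⁻¹) p T ≤ powerMean (α - 1) p p := by
  rw [powerMean_eq_mul_powerMean_div_escort hα hp]
  exact mul_le_of_le_one_right' (powerMean_div_self_le_one
    (sub_le_self 1 (inv_nonneg.2 hα.le)) (escort_mem_stdSimplex hα hp) hT)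

theorem powerMean_escort (hα : 0 < α) (hp : p ∈ stdSimplex ℝ≥0∞ ι) :
    powerMean (1 - α⁻¹) p (escort α p) = powerMean (α - 1) p p := by
  have hu := escort_mem_stdSimplex hα hp
  rw [powerMean_eq_mul_powerMean_div_escort hα hp, powerMean_congr (g := fun _ => 1) _
    fun i hi => ENNReal.div_self hi (ne_top_of_mem_stdSimplex hu i), powerMean_const hu, mul_one]

theorem powerMean_self_le_one (hp : p ∈ stdSimplex ℝ≥0∞ ι) (s : ℝ) : powerMean s p p ≤ 1 :=
  (powerMean_mono s p fun i => le_one_of_mem_stdSimplex hp i).trans_eq (powerMean_const hp s 1)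

theorem powerMean_self_ne_zero (hp : p ∈ stdSimplex ℝ≥0∞ ι) (s : ℝ) : powerMean s p p ≠ 0 :=
  powerMean_ne_zero hp (fun _ hi => hi) s

theorem powerMean_self_ne_top (hp : p ∈ stdSimplex ℝ≥0∞ ι) (s : ℝ) : powerMean s p p ≠ ∞ :=
  ne_top_of_le_ne_top ENNReal.one_ne_top (powerMean_self_le_one hp s)

theorem eq_escort_of_powerMean_eq (hα : 0 < α) (hp : p ∈ stdSimplex ℝ≥0∞ ι)
    (hT : T ∈ stdSimplex ℝ≥0∞ ι) (h : powerMean (1 - α⁻¹) p T = powerMean (α - 1) p p) :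
    T = escort α p := by
  refine eq_of_powerMean_div_self_eq_one (sub_lt_self 1 (inv_pos.2 hα))
    (escort_mem_stdSimplex hα hp) hT ?_
  rw [powerMean_eq_mul_powerMean_div_escort hα hp] at h
  exact (ENNReal.mul_eq_left (powerMean_self_ne_zero hp _) (powerMean_self_ne_top hp _)).1 h

end GibbsHolder

section EscortSubstitution

variable [Fintype ι] {P T : ι → ℝ≥0∞} {α : ℝ}

theorem relEntropy_eq_log_powerMean_div (hP : P ∈ stdSimplex ℝ≥0∞ ι) (hT : ∀ i, T i ≠ ∞) :
    relEntropy P T = ENNReal.log (powerMean 0 P P / powerMean 0 P T) := by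
  have h_inv : powerMean 0 P T⁻¹ = (powerMean 0 P T)⁻¹ := by
    have := powerMean_zero_inv (p := P) (f := T⁻¹) fun i _ => ENNReal.inv_ne_zero.2 (hT i)
    rw [← inv_inv (powerMean 0 P T⁻¹), ← this, inv_inv]
  rw [div_eq_mul_inv, ← h_inv, ← powerMean_zero_mul, log_powerMean_zero hP]
  rfl

theorem sum_mul_escort_inv_rpow (hα : 0 < α) (hα1 : α ≠ 1) (hT : T ∈ stdSimplex ℝ≥0∞ ι) :
    ∑ i, P i * escort α⁻¹ T i ^ (α - 1) =
      (∑ i, T i ^ α⁻¹) ^ (1 - α) * powerMean (1 - α⁻¹) P T ^ (1 - α⁻¹) := by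
  have hs : 1 - α⁻¹ ≠ 0 := sub_ne_zero.2 fun h => hα1 (inv_eq_one.1 h.symm)
  simp only [escort_apply_rpow (inv_pos.2 hα) hT, powerMean_rpow hs, Finset.mul_sum, neg_sub,
    mul_sub, inv_mul_cancel₀ hα.ne', mul_one]
  exact Finset.sum_congr rfl fun i _ => by ring

theorem relAlphaEntropy_escort (hα : 0 < α) (hP : P ∈ stdSimplex ℝ≥0∞ ι)
    (hT : T ∈ stdSimplex ℝ≥0∞ ι) : relAlphaEntropy α P (escort α⁻¹ T) =
      ENNReal.log (powerMean (α - 1) P P / powerMean (1 - α⁻¹) P T) := by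
  rcases eq_or_ne α 1 with rfl | hα1
  · rw [relAlphaEntropy, if_pos rfl, inv_one, escort_one hT, sub_self,
      relEntropy_eq_log_powerMean_div hP (ne_top_of_mem_stdSimplex hT)]
  · have hα1' : 1 - α ≠ 0 := sub_ne_zero.2 hα1.symm
    have hα1'' : α - 1 ≠ 0 := sub_ne_zero.2 hα1
    set Z := ∑ i, T i ^ α⁻¹
    have hZ0 : Z ≠ 0 := sum_rpow_ne_zero (inv_pos.2 hα) hT
    have hZ : Z ≠ ∞ := sum_rpow_ne_top (inv_pos.2 hα).le hT
    have h_norm : ∑ i, escort α⁻¹ T i ^ α = Z ^ (-α) := by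
      simp only [sum_escort_rpow (inv_pos.2 hα) hT, inv_mul_cancel₀ hα.ne', ENNReal.rpow_one,
        hT.2, one_mul, Z]
    have h_self : ∑ i, P i ^ α = powerMean (α - 1) P P ^ (α - 1) := by
      simp only [powerMean_rpow hα1'', rpow_mul_rpow_sub_one hα (ne_top_of_mem_stdSimplex hP _)]
    have h_first : (Z ^ (1 - α) * powerMean (1 - α⁻¹) P T ^ (1 - α⁻¹)) ^ (α / (1 - α)) * Z ^ (-α) =
        (powerMean (1 - α⁻¹) P T)⁻¹ := by
      have h_exp : (1 - α⁻¹) * (α / (1 - α)) = -1 := by field_simp; ring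
      rw [mul_rpow_of_ne_zero_of_ne_top (ENNReal.rpow_pos (pos_iff_ne_zero.2 hZ0) hZ).ne'
        (ENNReal.rpow_ne_top_of_ne_zero hZ0 hZ), ← ENNReal.rpow_mul, ← ENNReal.rpow_mul,
        mul_div_cancel₀ _ hα1', h_exp, mul_right_comm, ← ENNReal.rpow_add _ _ hZ0 hZ,
        add_neg_cancel, ENNReal.rpow_zero, one_mul, ENNReal.rpow_neg_one]
    have h_last :
        (powerMean (α - 1) P P ^ (α - 1)) ^ (1 / (1 - α)) = (powerMean (α - 1) P P)⁻¹ := by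
      rw [← ENNReal.rpow_mul, ← ENNReal.rpow_neg_one]
      congr 1
      field_simp
      ring
    rw [relAlphaEntropy, if_neg hα1, sum_mul_escort_inv_rpow hα hα1 hT, h_norm, h_self,
      ← ENNReal.log_rpow, ← ENNReal.log_rpow, ← ENNReal.log_mul_add, h_first, h_last,
      sub_eq_add_neg, ← ENNReal.log_inv, ← ENNReal.log_mul_add, inv_inv, mul_comm, div_eq_mul_inv]

end EscortSubstitution

section MinDiv

variable [Fintype ι] [Fintype κ] {P : ι × κ → ℝ≥0∞} {α : ℝ}

/-- The least relative `α`-entropy of the joint mass function `P` from a product of two probability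
mass functions, so that `K_α(X;Y)` is `minDiv α P_XY`. -/
noncomputable def minDiv (α : ℝ) (P : ι × κ → ℝ≥0∞) : EReal :=
  ⨅ (p : PMF ι) (q : PMF κ), relAlphaEntropy α P (prodPmf p q)

/-- The largest power mean of order `s`, with weights `P`, of a product of two probability mass
functions. By the escort substitution, minimising `relAlphaEntropy α P` over products is the same
as maximising the power mean of order `1 - α⁻¹`. -/
noncomputable def maxProductMean (s : ℝ) (P : ι × κ → ℝ≥0∞) : ℝ≥0∞ :=
  ⨆ v : stdSimplex ℝ≥0∞ ι × stdSimplex ℝ≥0∞ κ, powerMean s P (prodPmf v.1 v.2)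

theorem powerMean_prodPmf_le_maxProductMean {r : ι → ℝ≥0∞} {t : κ → ℝ≥0∞}
    (hr : r ∈ stdSimplex ℝ≥0∞ ι) (ht : t ∈ stdSimplex ℝ≥0∞ κ) (s : ℝ) (P : ι × κ → ℝ≥0∞) :
    powerMean s P (prodPmf r t) ≤ maxProductMean s P :=
  le_iSup (fun v : stdSimplex ℝ≥0∞ ι × stdSimplex ℝ≥0∞ κ => powerMean s P (prodPmf v.1 v.2))
    (⟨r, hr⟩, ⟨t, ht⟩)

theorem maxProductMean_le {s : ℝ} {c : ℝ≥0∞} (h : ∀ r ∈ stdSimplex ℝ≥0∞ ι,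
    ∀ t ∈ stdSimplex ℝ≥0∞ κ, powerMean s P (prodPmf r t) ≤ c) : maxProductMean s P ≤ c :=
  iSup_le fun v => h _ v.1.2 _ v.2.2

instance : CompactSpace (stdSimplex ℝ≥0∞ ι) :=
  isCompact_iff_compactSpace.1 isCompact_stdSimplex_ennreal

theorem continuous_prodPmf :
    Continuous fun v : stdSimplex ℝ≥0∞ ι × stdSimplex ℝ≥0∞ κ => prodPmf v.1 v.2 := by
  refine continuous_pi fun z => continuous_iff_continuousAt.2 fun v => ?_
  exact ENNReal.Tendsto.mul
    ((continuous_apply z.1).comp (continuous_subtype_val.comp continuous_fst)).continuousAt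
    (.inr (ne_top_of_mem_stdSimplex v.2.2 z.2))
    ((continuous_apply z.2).comp (continuous_subtype_val.comp continuous_snd)).continuousAt
    (.inr (ne_top_of_mem_stdSimplex v.1.2 z.1))

theorem continuous_powerMean_prodPmf (hP : P ∈ stdSimplex ℝ≥0∞ (ι × κ)) :
    Continuous fun w : ℝ × (stdSimplex ℝ≥0∞ ι × stdSimplex ℝ≥0∞ κ) =>
      powerMean w.1 P (prodPmf w.2.1 w.2.2) :=
  continuous_iff_continuousAt.2 fun w =>
    (continuousAt_powerMean hP (ne_top_of_mem_stdSimplex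
      (prodPmf_mem_stdSimplex w.2.1.2 w.2.2.2)) w.1).comp₂_of_eq continuousAt_fst
        (continuous_prodPmf.comp continuous_snd).continuousAt rfl

theorem continuous_maxProductMean (hP : P ∈ stdSimplex ℝ≥0∞ (ι × κ)) :
    Continuous fun s => maxProductMean s P := by
  have h := isCompact_univ.continuous_sSup
    (f := fun s (v : stdSimplex ℝ≥0∞ ι × stdSimplex ℝ≥0∞ κ) => powerMean s P (prodPmf v.1 v.2))
    (continuous_powerMean_prodPmf hP)
  simp only [Set.image_univ] at h
  exact h

theorem exists_powerMean_prodPmf_eq_maxProductMean (hP : P ∈ stdSimplex ℝ≥0∞ (ι × κ)) (s : ℝ) :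
    ∃ r ∈ stdSimplex ℝ≥0∞ ι, ∃ t ∈ stdSimplex ℝ≥0∞ κ,
      powerMean s P (prodPmf r t) = maxProductMean s P := by
  have : Nonempty (stdSimplex ℝ≥0∞ ι × stdSimplex ℝ≥0∞ κ) :=
    ⟨⟨_, mapPmf_mem_stdSimplex Prod.fst hP⟩, ⟨_, mapPmf_mem_stdSimplex Prod.snd hP⟩⟩
  obtain ⟨v, -, hv⟩ := isCompact_univ.exists_sSup_image_eq Set.univ_nonempty
    ((continuous_powerMean_prodPmf hP).comp (Continuous.prodMk_right s)).continuousOn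
  rw [Set.image_univ] at hv
  exact ⟨v.1, v.1.2, v.2, v.2.2, hv.symm⟩

theorem relAlphaEntropy_escort_prodPmf (hα : 0 < α) (hP : P ∈ stdSimplex ℝ≥0∞ (ι × κ))
    {r : ι → ℝ≥0∞} {t : κ → ℝ≥0∞} (hr : r ∈ stdSimplex ℝ≥0∞ ι) (ht : t ∈ stdSimplex ℝ≥0∞ κ) :
    relAlphaEntropy α P (prodPmf (escort α⁻¹ r) (escort α⁻¹ t)) =
      ENNReal.log (powerMean (α - 1) P P / powerMean (1 - α⁻¹) P (prodPmf r t)) := by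
  rw [← escort_prodPmf (inv_pos.2 hα) hr,
    relAlphaEntropy_escort hα hP (prodPmf_mem_stdSimplex hr ht)]

theorem exists_relAlphaEntropy_eq_log (hα : 0 < α) (hP : P ∈ stdSimplex ℝ≥0∞ (ι × κ)) :
    ∃ (p : PMF ι) (q : PMF κ), relAlphaEntropy α P (prodPmf p q) =
      ENNReal.log (powerMean (α - 1) P P / maxProductMean (1 - α⁻¹) P) := by
  obtain ⟨r, hr, t, ht, h⟩ := exists_powerMean_prodPmf_eq_maxProductMean hP (1 - α⁻¹)
  obtain ⟨p, hp⟩ := exists_pmf_coe_eq (escort_mem_stdSimplex (inv_pos.2 hα) hr)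
  obtain ⟨q, hq⟩ := exists_pmf_coe_eq (escort_mem_stdSimplex (inv_pos.2 hα) ht)
  exact ⟨p, q, by rw [hp, hq, relAlphaEntropy_escort_prodPmf hα hP hr ht, h]⟩

theorem log_le_relAlphaEntropy_prodPmf (hα : 0 < α) (hP : P ∈ stdSimplex ℝ≥0∞ (ι × κ))
    {p : ι → ℝ≥0∞} {q : κ → ℝ≥0∞} (hp : p ∈ stdSimplex ℝ≥0∞ ι) (hq : q ∈ stdSimplex ℝ≥0∞ κ) :
    ENNReal.log (powerMean (α - 1) P P / maxProductMean (1 - α⁻¹) P) ≤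
      relAlphaEntropy α P (prodPmf p q) := by
  have hp' := escort_mem_stdSimplex hα hp
  have hq' := escort_mem_stdSimplex hα hq
  rw [← escort_inv_escort hα hp, ← escort_inv_escort hα hq,
    relAlphaEntropy_escort_prodPmf hα hP hp' hq']
  exact ENNReal.log_monotone
    (ENNReal.div_le_div_left (powerMean_prodPmf_le_maxProductMean hp' hq' _ P) _)

theorem minDiv_eq_log (hα : 0 < α) (hP : P ∈ stdSimplex ℝ≥0∞ (ι × κ)) :
    minDiv α P = ENNReal.log (powerMean (α - 1) P P / maxProductMean (1 - α⁻¹) P) := by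
  refine le_antisymm ?_ ?_
  · obtain ⟨p, q, h⟩ := exists_relAlphaEntropy_eq_log hα hP
    rw [← h]
    exact (iInf_le _ p).trans (iInf_le _ q)
  · refine le_iInf₂ fun p q => ?_
    exact log_le_relAlphaEntropy_prodPmf hα hP (pmf_mem_stdSimplex p) (pmf_mem_stdSimplex q)

theorem exists_relAlphaEntropy_eq_minDiv (hα : 0 < α) (hP : P ∈ stdSimplex ℝ≥0∞ (ι × κ)) :
    ∃ (p : PMF ι) (q : PMF κ), relAlphaEntropy α P (prodPmf p q) = minDiv α P :=
  minDiv_eq_log hα hP ▸ exists_relAlphaEntropy_eq_log hα hP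

theorem maxProductMean_ne_zero (hP : P ∈ stdSimplex ℝ≥0∞ (ι × κ)) (s : ℝ) :
    maxProductMean s P ≠ 0 := by
  refine ne_bot_of_le_ne_bot (powerMean_ne_zero hP (fun z hz => ?_) s)
    (powerMean_prodPmf_le_maxProductMean (mapPmf_mem_stdSimplex Prod.fst hP)
      (mapPmf_mem_stdSimplex Prod.snd hP) s P)
  exact mul_ne_zero (ne_bot_of_le_ne_bot hz (le_mapPmf_apply Prod.fst P z))
    (ne_bot_of_le_ne_bot hz (le_mapPmf_apply Prod.snd P z))

theorem maxProductMean_le_one (hP : P ∈ stdSimplex ℝ≥0∞ (ι × κ)) (s : ℝ) :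
    maxProductMean s P ≤ 1 :=
  maxProductMean_le fun _ hr _ ht =>
    (powerMean_mono s P (le_one_of_mem_stdSimplex (prodPmf_mem_stdSimplex hr ht))).trans_eq
      (powerMean_const hP s 1)

theorem maxProductMean_ne_top (hP : P ∈ stdSimplex ℝ≥0∞ (ι × κ)) (s : ℝ) :
    maxProductMean s P ≠ ∞ :=
  ne_top_of_le_ne_top ENNReal.one_ne_top (maxProductMean_le_one hP s)

theorem continuousOn_minDiv (hP : P ∈ stdSimplex ℝ≥0∞ (ι × κ)) :
    ContinuousOn (fun α => minDiv α P) (Set.Ioi 0) := by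
  have h_self : Continuous fun s => powerMean s P P := continuous_iff_continuousAt.2 fun s =>
    (continuousAt_powerMean hP (ne_top_of_mem_stdSimplex hP) s).comp₂_of_eq continuousAt_id
      continuousAt_const rfl
  have h_inv : ContinuousOn (fun α : ℝ => 1 - α⁻¹) (Set.Ioi 0) :=
    continuousOn_const.sub (continuousOn_id.inv₀ fun α hα => ne_of_gt hα)
  have h_max := (continuous_maxProductMean hP).comp_continuousOn h_inv
  refine ContinuousOn.congr (fun α hα => ?_) fun α hα => minDiv_eq_log hα hP
  exact (ENNReal.continuous_log.tendsto _).comp (ENNReal.Tendsto.div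
    (h_self.comp (continuous_sub_right 1)).continuousWithinAt
    (.inl (powerMean_self_ne_zero hP _)) (h_max α hα) (.inl (maxProductMean_ne_top hP _)))

theorem maxProductMean_le_powerMean_self (hα : 0 < α) (hP : P ∈ stdSimplex ℝ≥0∞ (ι × κ)) :
    maxProductMean (1 - α⁻¹) P ≤ powerMean (α - 1) P P :=
  maxProductMean_le fun _ hr _ ht =>
    powerMean_le_powerMean_self hα hP (prodPmf_mem_stdSimplex hr ht)

end MinDiv

section MinDivProperties

variable [Fintype ι] [Fintype κ] {P : ι × κ → ℝ≥0∞} {p : ι → ℝ≥0∞} {q : κ → ℝ≥0∞} {α : ℝ}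

theorem minDiv_nonneg (hα : 0 < α) (hP : P ∈ stdSimplex ℝ≥0∞ (ι × κ)) : 0 ≤ minDiv α P := by
  rw [minDiv_eq_log hα hP, ENNReal.zero_le_log_iff, ENNReal.le_div_iff_mul_le
    (.inl (maxProductMean_ne_zero hP _)) (.inl (maxProductMean_ne_top hP _)), one_mul]
  exact maxProductMean_le_powerMean_self hα hP

theorem minDiv_eq_zero_iff_maxProductMean (hα : 0 < α) (hP : P ∈ stdSimplex ℝ≥0∞ (ι × κ)) :
    minDiv α P = 0 ↔ maxProductMean (1 - α⁻¹) P = powerMean (α - 1) P P := by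
  rw [minDiv_eq_log hα hP, ENNReal.log_eq_one_iff, ENNReal.div_eq_one_iff
    (maxProductMean_ne_zero hP _) (maxProductMean_ne_top hP _), eq_comm]

theorem maxProductMean_prodPmf (hα : 0 < α) (hp : p ∈ stdSimplex ℝ≥0∞ ι)
    (hq : q ∈ stdSimplex ℝ≥0∞ κ) :
    maxProductMean (1 - α⁻¹) (prodPmf p q) = powerMean (α - 1) (prodPmf p q) (prodPmf p q) := by
  have hpq := prodPmf_mem_stdSimplex hp hq
  refine le_antisymm (maxProductMean_le_powerMean_self hα hpq) ?_
  rw [← powerMean_escort hα hpq, escort_prodPmf hα hp]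
  exact powerMean_prodPmf_le_maxProductMean (escort_mem_stdSimplex hα hp)
    (escort_mem_stdSimplex hα hq) _ _

theorem minDiv_eq_zero_iff (hα : 0 < α) (hP : P ∈ stdSimplex ℝ≥0∞ (ι × κ)) :
    minDiv α P = 0 ↔ P = prodPmf (mapPmf Prod.fst P) (mapPmf Prod.snd P) := by
  rw [minDiv_eq_zero_iff_maxProductMean hα hP]
  constructor
  · intro h
    obtain ⟨r, hr, t, ht, h_max⟩ := exists_powerMean_prodPmf_eq_maxProductMean hP (1 - α⁻¹)
    have h_escort : prodPmf r t = escort α P :=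
      eq_escort_of_powerMean_eq hα hP (prodPmf_mem_stdSimplex hr ht) (h_max.trans h)
    have h_prod : P = prodPmf (escort α⁻¹ r) (escort α⁻¹ t) := by
      rw [← escort_prodPmf (inv_pos.2 hα) hr, h_escort, escort_inv_escort hα hP]
    have hr' := escort_mem_stdSimplex (inv_pos.2 hα) hr
    have ht' := escort_mem_stdSimplex (inv_pos.2 hα) ht
    rw [h_prod, mapPmf_fst_prodPmf _ ht', mapPmf_snd_prodPmf hr']
  · intro h
    rw [h]
    exact maxProductMean_prodPmf hα (mapPmf_mem_stdSimplex _ hP) (mapPmf_mem_stdSimplex _ hP)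

theorem powerMean_mapPmf_self (hp : p ∈ stdSimplex ℝ≥0∞ ι) {φ : ι → κ} (hφ : φ.Injective)
    (s : ℝ) : powerMean s (mapPmf φ p) (mapPmf φ p) = powerMean s p p := by
  rw [powerMean_mapPmf hp]
  congr 1
  ext i
  exact mapPmf_apply_of_injective hφ p i

theorem maxProductMean_swap (hP : P ∈ stdSimplex ℝ≥0∞ (ι × κ)) (s : ℝ) :
    maxProductMean s (mapPmf Prod.swap P) = maxProductMean s P := by
  refine (Equiv.prodComm _ _).iSup_congr fun v => ?_
  rw [powerMean_mapPmf hP]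
  congr 1
  ext z
  exact mul_comm _ _

theorem minDiv_swap (hα : 0 < α) (hP : P ∈ stdSimplex ℝ≥0∞ (ι × κ)) :
    minDiv α (mapPmf Prod.swap P) = minDiv α P := by
  rw [minDiv_eq_log hα (mapPmf_mem_stdSimplex _ hP), minDiv_eq_log hα hP, maxProductMean_swap hP,
    powerMean_mapPmf_self hP Prod.swap_injective]

theorem powerMean_self_le_card_mul_maxProductMean (hα : 0 < α)
    (hP : P ∈ stdSimplex ℝ≥0∞ (ι × κ)) :
    powerMean (α - 1) P P ≤ Fintype.card ι * maxProductMean (1 - α⁻¹) P := by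
  set q := mapPmf Prod.snd P
  have hq : q ∈ stdSimplex ℝ≥0∞ κ := mapPmf_mem_stdSimplex _ hP
  obtain ⟨i, -⟩ := exists_ne_zero_of_mem_stdSimplex (mapPmf_mem_stdSimplex Prod.fst hP)
  have : Nonempty ι := ⟨i⟩
  have h_card : (Fintype.card ι : ℝ≥0∞) ≠ 0 := Nat.cast_ne_zero.2 Fintype.card_ne_zero
  have h_card' : (Fintype.card ι : ℝ≥0∞) ≠ ∞ := ENNReal.natCast_ne_top _
  set r : ι → ℝ≥0∞ := fun _ => (Fintype.card ι : ℝ≥0∞)⁻¹ with hr_def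
  have hr : r ∈ stdSimplex ℝ≥0∞ ι :=
    ⟨fun _ => zero_le, by simp [hr_def, ENNReal.mul_inv_cancel h_card h_card']⟩
  calc powerMean (α - 1) P P
      ≤ powerMean (α - 1) P (q ∘ Prod.snd) := powerMean_mono _ _ (le_mapPmf_apply Prod.snd P)
    _ = powerMean (1 - α⁻¹) P (escort α q ∘ Prod.snd) := by
        rw [← powerMean_mapPmf hP, ← powerMean_mapPmf hP, powerMean_escort hα hq]
    _ = Fintype.card ι * powerMean (1 - α⁻¹) P (prodPmf r (escort α q)) := by
        rw [show prodPmf r (escort α q) = fun z => (Fintype.card ι : ℝ≥0∞)⁻¹ *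
          (escort α q ∘ Prod.snd) z from rfl, powerMean_const_mul hP _
          (ENNReal.inv_ne_top.2 h_card), ← mul_assoc, ENNReal.mul_inv_cancel h_card h_card',
          one_mul]
    _ ≤ Fintype.card ι * maxProductMean (1 - α⁻¹) P := by
        gcongr
        exact powerMean_prodPmf_le_maxProductMean hr (escort_mem_stdSimplex hα hq) _ P

theorem minDiv_le_log_card (hα : 0 < α) (hP : P ∈ stdSimplex ℝ≥0∞ (ι × κ)) :
    minDiv α P ≤ ENNReal.log (Fintype.card ι) := by
  rw [minDiv_eq_log hα hP]
  exact ENNReal.log_monotone ((ENNReal.div_le_iff (maxProductMean_ne_zero hP _)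
    (maxProductMean_ne_top hP _)).2 (powerMean_self_le_card_mul_maxProductMean hα hP))

theorem powerMean_zero_le_powerMean_zero_self {r : ι → ℝ≥0∞} (hp : p ∈ stdSimplex ℝ≥0∞ ι)
    (hr : r ∈ stdSimplex ℝ≥0∞ ι) : powerMean 0 p r ≤ powerMean 0 p p := by
  simpa using powerMean_le_powerMean_self one_pos hp hr

theorem maxProductMean_zero (hP : P ∈ stdSimplex ℝ≥0∞ (ι × κ)) :
    maxProductMean 0 P = powerMean 0 P (prodPmf (mapPmf Prod.fst P) (mapPmf Prod.snd P)) := by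
  have h_split (r : ι → ℝ≥0∞) (t : κ → ℝ≥0∞) : powerMean 0 P (prodPmf r t) =
      powerMean 0 (mapPmf Prod.fst P) r * powerMean 0 (mapPmf Prod.snd P) t := by
    rw [powerMean_mapPmf hP, powerMean_mapPmf hP, ← powerMean_zero_mul]
    rfl
  have h₁ := mapPmf_mem_stdSimplex Prod.fst hP
  have h₂ := mapPmf_mem_stdSimplex Prod.snd hP
  refine le_antisymm (maxProductMean_le fun r hr t ht => ?_)
    (powerMean_prodPmf_le_maxProductMean h₁ h₂ 0 P)
  rw [h_split, h_split]
  exact mul_le_mul' (powerMean_zero_le_powerMean_zero_self h₁ hr)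
    (powerMean_zero_le_powerMean_zero_self h₂ ht)

theorem minDiv_one (hP : P ∈ stdSimplex ℝ≥0∞ (ι × κ)) :
    minDiv 1 P = relEntropy P (prodPmf (mapPmf Prod.fst P) (mapPmf Prod.snd P)) := by
  rw [minDiv_eq_log one_pos hP, relEntropy_eq_log_powerMean_div hP (ne_top_of_mem_stdSimplex
    (prodPmf_mem_stdSimplex (mapPmf_mem_stdSimplex _ hP) (mapPmf_mem_stdSimplex _ hP))),
    inv_one, sub_self, maxProductMean_zero hP]

end MinDivProperties

section Additivity

variable {ι' κ' : Type*} [Fintype ι] [Fintype κ] [Fintype ι'] [Fintype κ']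
  {P₁ : ι × κ → ℝ≥0∞} {P₂ : ι' × κ' → ℝ≥0∞} {α : ℝ}

/-- The joint mass function of `((X₁, X₂), (Y₁, Y₂))` for independent pairs `(X₁, Y₁)` and
`(X₂, Y₂)` with joint mass functions `P₁` and `P₂`. -/
noncomputable def tensorPmf (P₁ : ι × κ → ℝ≥0∞) (P₂ : ι' × κ' → ℝ≥0∞) :
    (ι × ι') × (κ × κ') → ℝ≥0∞ :=
  mapPmf (Equiv.prodProdProdComm ι κ ι' κ') (prodPmf P₁ P₂)

theorem tensorPmf_mem_stdSimplex (h₁ : P₁ ∈ stdSimplex ℝ≥0∞ (ι × κ))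
    (h₂ : P₂ ∈ stdSimplex ℝ≥0∞ (ι' × κ')) :
    tensorPmf P₁ P₂ ∈ stdSimplex ℝ≥0∞ ((ι × ι') × (κ × κ')) :=
  mapPmf_mem_stdSimplex _ (prodPmf_mem_stdSimplex h₁ h₂)

theorem powerMean_prodPmf_prodPmf {p f : ι → ℝ≥0∞} {q g : κ → ℝ≥0∞}
    (hp : p ∈ stdSimplex ℝ≥0∞ ι) (hq : q ∈ stdSimplex ℝ≥0∞ κ) (hf : ∀ i, f i ≠ ∞)
    (s : ℝ) (hg : powerMean s q g ≠ ∞) :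
    powerMean s (prodPmf p q) (prodPmf f g) = powerMean s p f * powerMean s q g := by
  rw [powerMean_prodPmf]
  simp only [prodPmf, powerMean_const_mul hq s (hf _)]
  simp only [mul_comm _ (powerMean s q g)]
  exact powerMean_const_mul hp s hg f

theorem powerMean_prodPmf_le_mul_maxProductMean (hP : P₁ ∈ stdSimplex ℝ≥0∞ (ι × κ)) (s : ℝ)
    {r : ι → ℝ≥0∞} {t : κ → ℝ≥0∞} (hr : ∑ i, r i ≠ ∞) (ht : ∑ k, t k ≠ ∞) :
    powerMean s P₁ (prodPmf r t) ≤ (∑ i, r i) * (∑ k, t k) * maxProductMean s P₁ := by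
  rcases eq_or_ne ((∑ i, r i) * ∑ k, t k) 0 with h0 | h0
  · have h_zero : prodPmf r t = fun _ => 0 := by
      ext z
      refine le_zero_iff.1 (le_trans (mul_le_mul' ?_ ?_) h0.le)
      · exact Finset.single_le_sum (fun _ _ => zero_le) (Finset.mem_univ z.1)
      · exact Finset.single_le_sum (fun _ _ => zero_le) (Finset.mem_univ z.2)
    rw [h_zero, powerMean_const hP]
    exact zero_le
  · obtain ⟨hr0, ht0⟩ := mul_ne_zero_iff.1 h0
    have h_norm : prodPmf r t = fun z => (∑ i, r i) * (∑ k, t k) *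
        prodPmf (fun i => r i / ∑ i, r i) (fun k => t k / ∑ k, t k) z := by
      ext z
      rw [prodPmf, prodPmf, mul_mul_mul_comm, ENNReal.mul_div_cancel hr0 hr,
        ENNReal.mul_div_cancel ht0 ht]
    rw [h_norm, powerMean_const_mul hP s (ENNReal.mul_ne_top hr ht)]
    gcongr
    refine powerMean_prodPmf_le_maxProductMean ⟨fun _ => zero_le, ?_⟩ ⟨fun _ => zero_le, ?_⟩ s P₁
    · simp only [div_eq_mul_inv, ← Finset.sum_mul, ENNReal.mul_inv_cancel hr0 hr]
    · simp only [div_eq_mul_inv, ← Finset.sum_mul, ENNReal.mul_inv_cancel ht0 ht]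

theorem maxProductMean_tensorPmf_le (h₁ : P₁ ∈ stdSimplex ℝ≥0∞ (ι × κ))
    (h₂ : P₂ ∈ stdSimplex ℝ≥0∞ (ι' × κ')) (s : ℝ) :
    maxProductMean s (tensorPmf P₁ P₂) ≤ maxProductMean s P₁ * maxProductMean s P₂ := by
  refine maxProductMean_le fun R hR T hT => ?_
  have hR₁ := mapPmf_mem_stdSimplex Prod.fst hR
  have hT₁ := mapPmf_mem_stdSimplex Prod.fst hT
  have h_slice : ∀ z : ι × κ,
      powerMean s P₂ (prodPmf (fun i => R (z.1, i)) fun k => T (z.2, k)) ≤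
        maxProductMean s P₂ * prodPmf (mapPmf Prod.fst R) (mapPmf Prod.fst T) z := by
    intro z
    have hRz := ne_top_of_mem_stdSimplex hR₁ z.1
    have hTz := ne_top_of_mem_stdSimplex hT₁ z.2
    rw [mapPmf_fst_apply] at hRz hTz
    rw [mul_comm, prodPmf, mapPmf_fst_apply, mapPmf_fst_apply]
    exact powerMean_prodPmf_le_mul_maxProductMean h₂ s hRz hTz
  rw [tensorPmf, powerMean_mapPmf (prodPmf_mem_stdSimplex h₁ h₂), powerMean_prodPmf]
  calc _ ≤ powerMean s P₁ fun z =>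
          maxProductMean s P₂ * prodPmf (mapPmf Prod.fst R) (mapPmf Prod.fst T) z :=
        powerMean_mono s P₁ h_slice
    _ = maxProductMean s P₂ * powerMean s P₁ (prodPmf (mapPmf Prod.fst R) (mapPmf Prod.fst T)) :=
        powerMean_const_mul h₁ s (maxProductMean_ne_top h₂ s) _
    _ ≤ maxProductMean s P₁ * maxProductMean s P₂ := by
        rw [mul_comm]
        gcongr
        exact powerMean_prodPmf_le_maxProductMean hR₁ hT₁ s P₁

theorem mul_maxProductMean_le_tensorPmf (h₁ : P₁ ∈ stdSimplex ℝ≥0∞ (ι × κ))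
    (h₂ : P₂ ∈ stdSimplex ℝ≥0∞ (ι' × κ')) (s : ℝ) :
    maxProductMean s P₁ * maxProductMean s P₂ ≤ maxProductMean s (tensorPmf P₁ P₂) := by
  obtain ⟨r₁, hr₁, t₁, ht₁, h_max₁⟩ := exists_powerMean_prodPmf_eq_maxProductMean h₁ s
  obtain ⟨r₂, hr₂, t₂, ht₂, h_max₂⟩ := exists_powerMean_prodPmf_eq_maxProductMean h₂ s
  have h_prod : prodPmf (prodPmf r₁ r₂) (prodPmf t₁ t₂) ∘ Equiv.prodProdProdComm ι κ ι' κ' =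
      prodPmf (prodPmf r₁ t₁) (prodPmf r₂ t₂) :=
    funext fun z => mul_mul_mul_comm _ _ _ _
  calc maxProductMean s P₁ * maxProductMean s P₂
      = powerMean s (prodPmf P₁ P₂) (prodPmf (prodPmf r₁ t₁) (prodPmf r₂ t₂)) := by
        rw [powerMean_prodPmf_prodPmf h₁ h₂
          (ne_top_of_mem_stdSimplex (prodPmf_mem_stdSimplex hr₁ ht₁)) s
          (h_max₂ ▸ maxProductMean_ne_top h₂ s), h_max₁, h_max₂]
    _ = powerMean s (tensorPmf P₁ P₂) (prodPmf (prodPmf r₁ r₂) (prodPmf t₁ t₂)) := by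
        rw [tensorPmf, powerMean_mapPmf (prodPmf_mem_stdSimplex h₁ h₂), h_prod]
    _ ≤ maxProductMean s (tensorPmf P₁ P₂) := powerMean_prodPmf_le_maxProductMean
        (prodPmf_mem_stdSimplex hr₁ hr₂) (prodPmf_mem_stdSimplex ht₁ ht₂) s _

theorem maxProductMean_tensorPmf (h₁ : P₁ ∈ stdSimplex ℝ≥0∞ (ι × κ))
    (h₂ : P₂ ∈ stdSimplex ℝ≥0∞ (ι' × κ')) (s : ℝ) :
    maxProductMean s (tensorPmf P₁ P₂) = maxProductMean s P₁ * maxProductMean s P₂ :=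
  le_antisymm (maxProductMean_tensorPmf_le h₁ h₂ s) (mul_maxProductMean_le_tensorPmf h₁ h₂ s)

theorem minDiv_tensorPmf (hα : 0 < α) (h₁ : P₁ ∈ stdSimplex ℝ≥0∞ (ι × κ))
    (h₂ : P₂ ∈ stdSimplex ℝ≥0∞ (ι' × κ')) :
    minDiv α (tensorPmf P₁ P₂) = minDiv α P₁ + minDiv α P₂ := by
  have h_self : powerMean (α - 1) (tensorPmf P₁ P₂) (tensorPmf P₁ P₂) =
      powerMean (α - 1) P₁ P₁ * powerMean (α - 1) P₂ P₂ := by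
    rw [tensorPmf, powerMean_mapPmf_self (prodPmf_mem_stdSimplex h₁ h₂) (Equiv.injective _),
      powerMean_prodPmf_prodPmf h₁ h₂ (ne_top_of_mem_stdSimplex h₁) _ (powerMean_self_ne_top h₂ _)]
  rw [minDiv_eq_log hα (tensorPmf_mem_stdSimplex h₁ h₂), minDiv_eq_log hα h₁, minDiv_eq_log hα h₂,
    h_self, maxProductMean_tensorPmf h₁ h₂, ← ENNReal.log_mul_add, ENNReal.mul_div_mul_comm
      (.inl (maxProductMean_ne_zero h₁ _)) (.inl (maxProductMean_ne_top h₁ _))]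

end Additivity

section Diagonal

variable [Fintype ι] {p : ι → ℝ≥0∞} {α s : ℝ} {c : ℝ≥0∞}

theorem mul_le_midpoint_rpow_two (x y : ℝ≥0∞) : x * y ≤ ((x + y) / 2) ^ (2 : ℝ) := by
  rw [ENNReal.rpow_two]
  rcases eq_or_ne (x + y) ∞ with h | h
  · simp [h, ENNReal.top_div_of_ne_top ENNReal.ofNat_ne_top]
  · obtain ⟨hx, hy⟩ := ENNReal.add_ne_top.1 h
    lift x to NNReal using hx
    lift y to NNReal using hy
    rw [← ENNReal.coe_ofNat, ← ENNReal.coe_add, ← ENNReal.coe_div two_ne_zero]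
    norm_cast
    rw [div_pow, le_div_iff₀ (by positivity)]
    linarith [four_mul_le_sq_add x y]

theorem maxProductMean_diag (h : IsGreatest (powerMean (2 * s) p '' stdSimplex ℝ≥0∞ ι) c)
    (hp : p ∈ stdSimplex ℝ≥0∞ ι) :
    maxProductMean s (mapPmf (fun i => (i, i)) p) = c ^ (2 : ℝ) := by
  obtain ⟨⟨T, hT, rfl⟩, h_le⟩ := h
  refine le_antisymm (maxProductMean_le fun r hr t ht => ?_) ?_
  · have h_mid : (fun i => (r i + t i) / 2) ∈ stdSimplex ℝ≥0∞ ι := ⟨fun _ => zero_le, by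
      simp only [div_eq_mul_inv, ← Finset.sum_mul, Finset.sum_add_distrib, hr.2, ht.2,
        one_add_one_eq_two]
      exact ENNReal.mul_inv_cancel two_ne_zero ENNReal.ofNat_ne_top⟩
    rw [powerMean_mapPmf hp]
    calc powerMean s p (prodPmf r t ∘ fun i => (i, i))
        ≤ powerMean s p fun i => ((r i + t i) / 2) ^ (2 : ℝ) :=
          powerMean_mono s p fun i => mul_le_midpoint_rpow_two (r i) (t i)
      _ = powerMean (2 * s) p (fun i => (r i + t i) / 2) ^ (2 : ℝ) := powerMean_sq s p _
      _ ≤ powerMean (2 * s) p T ^ (2 : ℝ) :=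
          ENNReal.rpow_le_rpow (h_le (Set.mem_image_of_mem _ h_mid)) zero_le_two
  · rw [← powerMean_sq]
    have h_sq : (fun i => T i ^ (2 : ℝ)) = prodPmf T T ∘ fun i => (i, i) :=
      funext fun i => (ENNReal.rpow_two _).trans (sq _)
    rw [h_sq, ← powerMean_mapPmf hp]
    exact powerMean_prodPmf_le_maxProductMean hT hT s _

theorem isGreatest_powerMean_escort (hα : 0 < α) (hp : p ∈ stdSimplex ℝ≥0∞ ι) :
    IsGreatest (powerMean (1 - α⁻¹) p '' stdSimplex ℝ≥0∞ ι) (powerMean (α - 1) p p) :=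
  ⟨⟨_, escort_mem_stdSimplex hα hp, powerMean_escort hα hp⟩,
    Set.forall_mem_image.2 fun _ hT => powerMean_le_powerMean_self hα hp hT⟩

theorem isGreatest_powerMean_single (hs : 1 ≤ s) (hp : p ∈ stdSimplex ℝ≥0∞ ι) :
    IsGreatest (powerMean s p '' stdSimplex ℝ≥0∞ ι) ((⨆ i, p i) ^ (1 / s)) := by
  classical
  have hs0 : 0 < s := zero_lt_one.trans_le hs
  constructor
  · obtain ⟨i, -⟩ := exists_ne_zero_of_mem_stdSimplex hp
    have : Nonempty ι := ⟨i⟩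
    obtain ⟨m, hm⟩ := exists_eq_ciSup_of_finite (f := p)
    refine ⟨Pi.single m 1, single_mem_stdSimplex _ m, ?_⟩
    rw [powerMean_of_ne_zero hs0.ne', Finset.sum_eq_single m, ← hm]
    · simp
    · intro i _ hi
      simp [hi, hs0]
    · simp
  · refine Set.forall_mem_image.2 fun T hT => ?_
    rw [powerMean_of_ne_zero hs0.ne']
    gcongr
    calc ∑ i, p i * T i ^ s ≤ ∑ i, (⨆ j, p j) * T i := by
          gcongr with i
          · exact le_iSup p i
          · exact ENNReal.rpow_le_self_of_le_one (le_one_of_mem_stdSimplex hT i) hs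
      _ = ⨆ i, p i := by rw [← Finset.mul_sum, hT.2, mul_one]

theorem minDiv_diag (hα : 0 < α) (hp : p ∈ stdSimplex ℝ≥0∞ ι)
    (h : IsGreatest (powerMean (2 * (1 - α⁻¹)) p '' stdSimplex ℝ≥0∞ ι) c) :
    minDiv α (mapPmf (fun i => (i, i)) p) =
      ENNReal.log (powerMean (α - 1) p p) - ((2 : ℝ) : EReal) * ENNReal.log c := by
  rw [minDiv_eq_log hα (mapPmf_mem_stdSimplex _ hp), maxProductMean_diag h hp,
    powerMean_mapPmf_self hp fun i j hij => congrArg Prod.fst hij, div_eq_mul_inv,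
    ENNReal.log_mul_add, ENNReal.log_inv, ENNReal.log_rpow, ← sub_eq_add_neg]

theorem minDiv_diag_of_lt_two (hα : 0 < α) (hα2 : α < 2) (hp : p ∈ stdSimplex ℝ≥0∞ ι) :
    minDiv α (mapPmf (fun i => (i, i)) p) = ENNReal.log (powerMean (α - 1) p p) -
      ((2 : ℝ) : EReal) * ENNReal.log (powerMean (α / (2 - α) - 1) p p) := by
  refine minDiv_diag hα hp ?_
  convert isGreatest_powerMean_escort (div_pos hα (sub_pos.2 hα2)) hp using 3
  field_simp
  ring

theorem minDiv_diag_of_two_le (hα : 2 ≤ α) (hp : p ∈ stdSimplex ℝ≥0∞ ι) :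
    minDiv α (mapPmf (fun i => (i, i)) p) = ENNReal.log (powerMean (α - 1) p p) -
      ((α / (α - 1) : ℝ) : EReal) * ENNReal.log (⨆ i, p i) := by
  have hα0 : 0 < α := zero_lt_two.trans_le hα
  have hs : 1 ≤ 2 * (1 - α⁻¹) := by
    have := inv_anti₀ zero_lt_two hα
    linarith
  have h_exp : 2 * (1 / (2 * (1 - α⁻¹))) = α / (α - 1) := by
    have : α - 1 ≠ 0 := by linarith
    field_simp
  rw [minDiv_diag hα0 hp (isGreatest_powerMean_single hs hp), ENNReal.log_rpow, ← mul_assoc,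
    ← EReal.coe_mul, h_exp]

end Diagonal

section RandomVariables

variable {Ω : Type*} [MeasurableSpace Ω] {μ : Measure Ω} [Fintype ι] [Fintype κ]
  [MeasurableSpace ι] [MeasurableSingletonClass ι] [MeasurableSpace κ]
  [MeasurableSingletonClass κ] {X : Ω → ι} {Y : Ω → κ} {α : ℝ}

omit [Fintype κ] [MeasurableSpace κ] [MeasurableSingletonClass κ] in
theorem pmfOf_comp (φ : ι → κ) (hX : Measurable X) :
    pmfOf μ (φ ∘ X) = mapPmf φ (pmfOf μ X) := by
  classical
  ext k
  have h_preimage : (φ ∘ X) ⁻¹' {k} = X ⁻¹' ↑(Finset.univ.filter fun i => φ i = k) := by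
    ext ω
    simp
  rw [pmfOf, h_preimage,
    ← sum_measure_preimage_singleton _ fun i _ => hX (measurableSet_singleton i), mapPmf]
  congr!

theorem pmfOf_mem_stdSimplex [IsProbabilityMeasure μ] (hX : Measurable X) :
    pmfOf μ X ∈ stdSimplex ℝ≥0∞ ι :=
  ⟨fun _ => zero_le, by
    simpa [pmfOf] using
      sum_measure_preimage_singleton (μ := μ) Finset.univ fun i _ => hX (measurableSet_singleton i)⟩

omit [Fintype ι] [Fintype κ] in
theorem indepFun_iff_pmfOf [Finite ι] [Finite κ] [IsProbabilityMeasure μ] (hX : Measurable X)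
    (hY : Measurable Y) : IndepFun X Y μ ↔
      pmfOf μ (fun ω => (X ω, Y ω)) = prodPmf (pmfOf μ X) (pmfOf μ Y) := by
  have h_pair : ∀ z : ι × κ, (fun ω => (X ω, Y ω)) ⁻¹' {z} = X ⁻¹' {z.1} ∩ Y ⁻¹' {z.2} :=
    fun z => by rw [← Set.mk_preimage_prod, Set.singleton_prod_singleton]
  constructor
  · intro h
    ext z
    rw [pmfOf, h_pair]
    exact h.measure_inter_preimage_eq_mul _ _ (measurableSet_singleton _)
      (measurableSet_singleton _)
  · intro h
    rw [indepFun_iff_map_prod_eq_prod_map_map hX.aemeasurable hY.aemeasurable]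
    refine Measure.ext_of_singleton fun z => ?_
    rw [Measure.map_apply (hX.prodMk hY) (measurableSet_singleton z),
      ← Set.singleton_prod_singleton, Measure.prod_prod,
      Measure.map_apply hX (measurableSet_singleton _),
      Measure.map_apply hY (measurableSet_singleton _), Set.singleton_prod_singleton]
    exact congrFun h z

theorem K_eq_zero_iff [IsProbabilityMeasure μ] (hα : 0 < α) (hX : Measurable X)
    (hY : Measurable Y) : K μ α X Y = 0 ↔ IndepFun X Y μ := by
  have hXY := hX.prodMk hY
  refine (minDiv_eq_zero_iff hα (pmfOf_mem_stdSimplex hXY)).trans ?_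
  rw [indepFun_iff_pmfOf hX hY, ← pmfOf_comp Prod.fst hXY, ← pmfOf_comp Prod.snd hXY]
  rfl

theorem K_comm [IsProbabilityMeasure μ] (hα : 0 < α) (hX : Measurable X) (hY : Measurable Y) :
    K μ α X Y = K μ α Y X := by
  have hXY := hX.prodMk hY
  refine (minDiv_swap hα (pmfOf_mem_stdSimplex hXY)).symm.trans ?_
  rw [← pmfOf_comp Prod.swap hXY]
  rfl

theorem K_prodMk [IsProbabilityMeasure μ] {ι' κ' : Type*} [Fintype ι'] [Fintype κ']
    [MeasurableSpace ι'] [MeasurableSingletonClass ι'] [MeasurableSpace κ']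
    [MeasurableSingletonClass κ'] {X' : Ω → ι'} {Y' : Ω → κ'} (hα : 0 < α) (hX : Measurable X)
    (hY : Measurable Y) (hX' : Measurable X') (hY' : Measurable Y')
    (h : IndepFun (fun ω => (X ω, Y ω)) (fun ω => (X' ω, Y' ω)) μ) :
    K μ α (fun ω => (X ω, X' ω)) (fun ω => (Y ω, Y' ω)) = K μ α X Y + K μ α X' Y' := by
  have hXY := hX.prodMk hY
  have hXY' := hX'.prodMk hY'
  refine Eq.trans ?_ (minDiv_tensorPmf hα (pmfOf_mem_stdSimplex hXY) (pmfOf_mem_stdSimplex hXY'))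
  rw [tensorPmf, ← (indepFun_iff_pmfOf hXY hXY').1 h, ← pmfOf_comp _ (hXY.prodMk hXY')]
  rfl

theorem K_one [IsProbabilityMeasure μ] (hX : Measurable X) (hY : Measurable Y) :
    K μ 1 X Y = mutualInfo μ X Y := by
  have hXY := hX.prodMk hY
  refine (minDiv_one (pmfOf_mem_stdSimplex hXY)).trans ?_
  rw [← pmfOf_comp Prod.fst hXY, ← pmfOf_comp Prod.snd hXY]
  rfl

theorem K_le_log_card [IsProbabilityMeasure μ] (hα : 0 < α) (hX : Measurable X)
    (hY : Measurable Y) : K μ α X Y ≤ ((Real.log (Fintype.card ι) : ℝ) : EReal) := by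
  obtain ⟨i, -⟩ := exists_ne_zero_of_mem_stdSimplex (pmfOf_mem_stdSimplex (μ := μ) hX)
  have : Nonempty ι := ⟨i⟩
  rw [← ENNReal.toReal_natCast, ← ENNReal.log_pos_real (Nat.cast_ne_zero.2 Fintype.card_ne_zero)
    (ENNReal.natCast_ne_top _)]
  exact minDiv_le_log_card hα (pmfOf_mem_stdSimplex (hX.prodMk hY))

theorem log_powerMean_pmfOf [IsProbabilityMeasure μ] (hα : 0 < α) (hX : Measurable X) :
    ENNReal.log (powerMean (α - 1) (pmfOf μ X) (pmfOf μ X)) =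
      ((-renyiEntropy μ α X : ℝ) : EReal) := by
  have hp := pmfOf_mem_stdSimplex (μ := μ) hX
  have hp' := ne_top_of_mem_stdSimplex hp
  rcases eq_or_ne α 1 with rfl | hα1
  · rw [sub_self, log_powerMean_zero hp, renyiEntropy, if_pos rfl, ← Finset.sum_neg_distrib,
      coe_sum_ereal]
    refine Finset.sum_congr rfl fun x _ => ?_
    rcases eq_or_ne (pmfOf μ X x) 0 with h0 | h0
    · simp [h0]
    · rw [ENNReal.log_pos_real h0 (hp' x), one_div, Real.log_inv, mul_neg, neg_neg, EReal.coe_mul,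
        EReal.coe_ennreal_toReal (hp' x)]
  · have hα1' : α - 1 ≠ 0 := sub_ne_zero.2 hα1
    rw [powerMean_of_ne_zero hα1', ENNReal.log_rpow, renyiEntropy, if_neg hα1, ← neg_mul,
      ← one_div_neg_eq_neg_one_div, neg_sub]
    simp only [rpow_mul_rpow_sub_one hα (hp' _)]
    rw [ENNReal.log_pos_real (sum_rpow_ne_zero hα hp) (sum_rpow_ne_top hα.le hp), EReal.coe_mul,
      ENNReal.toReal_sum fun x _ => ENNReal.rpow_ne_top_of_nonneg hα.le (hp' x)]
    simp only [ENNReal.toReal_rpow]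

omit [Fintype ι] in
theorem log_iSup_pmfOf [Finite ι] [IsProbabilityMeasure μ] (hX : Measurable X) :
    ENNReal.log (⨆ x, pmfOf μ X x) = ((-minEntropy μ X : ℝ) : EReal) := by
  have := Fintype.ofFinite ι
  have hp := pmfOf_mem_stdSimplex (μ := μ) hX
  obtain ⟨x, hx⟩ := exists_ne_zero_of_mem_stdSimplex hp
  have h0 : ⨆ x, pmfOf μ X x ≠ 0 := ne_bot_of_le_ne_bot hx (le_iSup _ x)
  have h_top : ⨆ x, pmfOf μ X x ≠ ∞ :=
    ne_top_of_le_ne_top ENNReal.one_ne_top (iSup_le (le_one_of_mem_stdSimplex hp))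
  rw [ENNReal.log_pos_real h0 h_top, minEntropy, neg_neg,
    ENNReal.toReal_iSup (ne_top_of_mem_stdSimplex hp)]

theorem K_self_of_lt_two [IsProbabilityMeasure μ] (hα : 0 < α) (hα2 : α < 2) (hX : Measurable X) :
    K μ α X X =
      ((2 * renyiEntropy μ (α / (2 - α)) X - renyiEntropy μ α X : ℝ) : EReal) := by
  have h := minDiv_diag_of_lt_two hα hα2 (pmfOf_mem_stdSimplex (μ := μ) hX)
  rw [← pmfOf_comp _ hX, log_powerMean_pmfOf hα hX,
    log_powerMean_pmfOf (div_pos hα (sub_pos.2 hα2)) hX] at h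
  refine h.trans ?_
  norm_cast
  ring

theorem K_self_of_two_le [IsProbabilityMeasure μ] (hα : 2 ≤ α) (hX : Measurable X) :
    K μ α X X = ((α / (α - 1) * minEntropy μ X - renyiEntropy μ α X : ℝ) : EReal) := by
  have h := minDiv_diag_of_two_le hα (pmfOf_mem_stdSimplex (μ := μ) hX)
  rw [← pmfOf_comp _ hX, log_powerMean_pmfOf (zero_lt_two.trans_le hα) hX,
    log_iSup_pmfOf hX] at h
  refine h.trans ?_
  norm_cast
  ring

end RandomVariables

end RelAlpha

theorem theorem2
    {Ω 𝒳 𝒴 𝒳₁ 𝒳₂ 𝒴₁ 𝒴₂ : Type*} [MeasurableSpace Ω]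
    [Fintype 𝒳] [MeasurableSpace 𝒳] [MeasurableSingletonClass 𝒳]
    [Fintype 𝒴] [MeasurableSpace 𝒴] [MeasurableSingletonClass 𝒴]
    [Fintype 𝒳₁] [MeasurableSpace 𝒳₁] [MeasurableSingletonClass 𝒳₁]
    [Fintype 𝒳₂] [MeasurableSpace 𝒳₂] [MeasurableSingletonClass 𝒳₂]
    [Fintype 𝒴₁] [MeasurableSpace 𝒴₁] [MeasurableSingletonClass 𝒴₁]
    [Fintype 𝒴₂] [MeasurableSpace 𝒴₂] [MeasurableSingletonClass 𝒴₂]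
    (μ : Measure Ω) [IsProbabilityMeasure μ]
    (X : Ω → 𝒳) (Y : Ω → 𝒴) (X₁ : Ω → 𝒳₁) (X₂ : Ω → 𝒳₂) (Y₁ : Ω → 𝒴₁) (Y₂ : Ω → 𝒴₂)
    (hX : Measurable X) (hY : Measurable Y) (hX₁ : Measurable X₁) (hX₂ : Measurable X₂)
    (hY₁ : Measurable Y₁) (hY₂ : Measurable Y₂) :
    (∀ α : ℝ, 0 < α →
      -- the minimum defining `K_α(X;Y)` is attained
      (∃ (QX : PMF 𝒳) (QY : PMF 𝒴),
        RelAlpha.relAlphaEntropy α (RelAlpha.pmfOf μ (fun ω => (X ω, Y ω)))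
          (RelAlpha.prodPmf QX QY) = RelAlpha.K μ α X Y) ∧
      -- nonnegativity
      0 ≤ RelAlpha.K μ α X Y ∧
      (RelAlpha.K μ α X Y = 0 ↔ IndepFun X Y μ) ∧
      -- symmetry
      RelAlpha.K μ α X Y = RelAlpha.K μ α Y X ∧
      -- additivity
      (IndepFun (fun ω => (X₁ ω, Y₁ ω)) (fun ω => (X₂ ω, Y₂ ω)) μ →
        RelAlpha.K μ α (fun ω => (X₁ ω, X₂ ω)) (fun ω => (Y₁ ω, Y₂ ω))
          = RelAlpha.K μ α X₁ Y₁ + RelAlpha.K μ α X₂ Y₂) ∧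
      -- upper bounds
      RelAlpha.K μ α X Y ≤ ((Real.log (Fintype.card 𝒳) : ℝ) : EReal) ∧
      RelAlpha.K μ α X Y ≤ ((Real.log (Fintype.card 𝒴) : ℝ) : EReal)) ∧
    -- order one
    RelAlpha.K μ 1 X Y = RelAlpha.mutualInfo μ X Y ∧
    -- continuity in `α`
    ContinuousOn (fun α : ℝ => RelAlpha.K μ α X Y) (Set.Ioi 0) ∧
    -- closed forms of `K_α(X;X)`
    (∀ α : ℝ, 0 < α → α < 2 →
      RelAlpha.K μ α X X = ((2 * RelAlpha.renyiEntropy μ (α / (2 - α)) X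
        - RelAlpha.renyiEntropy μ α X : ℝ) : EReal)) ∧
    (∀ α : ℝ, 2 ≤ α →
      RelAlpha.K μ α X X = ((α / (α - 1) * RelAlpha.minEntropy μ X
        - RelAlpha.renyiEntropy μ α X : ℝ) : EReal)) := by
  have hXY := RelAlpha.pmfOf_mem_stdSimplex (μ := μ) (hX.prodMk hY)
  refine ⟨fun α hα => ⟨?attained, ?nonneg, ?eq_zero, ?symm, ?additive, ?card_left, ?card_right⟩,
    ?one, ?continuous, ?self_of_lt_two, ?self_of_two_le⟩
  case attained => exact RelAlpha.exists_relAlphaEntropy_eq_minDiv hα hXY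
  case nonneg => exact RelAlpha.minDiv_nonneg hα hXY
  case eq_zero => exact RelAlpha.K_eq_zero_iff hα hX hY
  case symm => exact RelAlpha.K_comm hα hX hY
  case additive => exact RelAlpha.K_prodMk hα hX₁ hY₁ hX₂ hY₂
  case card_left => exact RelAlpha.K_le_log_card hα hX hY
  case card_right => exact (RelAlpha.K_comm hα hX hY).trans_le (RelAlpha.K_le_log_card hα hY hX)
  case one => exact RelAlpha.K_one hX hY
  case continuous => exact RelAlpha.continuousOn_minDiv hXY
  case self_of_lt_two => exact fun α hα hα2 => RelAlpha.K_self_of_lt_two hα hα2 hX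
  case self_of_two_le => exact fun α hα => RelAlpha.K_self_of_two_le hα hX
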